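/- Let $\mathrm{SQiSW}$ be the two-qubit gate given in the ordered computational basis $|00\rangle,|01\rangle,|10\rangle,|11\rangle$ by $$\mathrm{SQiSW}=\begin{pmatrix}1&0&0&0\\0&\frac{1}{\sqrt2}&\frac{i}{\sqrt2}&0\\0&\frac{i}{\sqrt2}&\frac1{\sqrt2}&0\\0&0&0&1\end{pmatrix}.$$ **Theorem.** Every two-qubit unitary can be expressed by at most three $\mathrm{SQiSW}$ gates interleaved by single-qubit gates. That is, for every $U\in U(4)$ (in particular, for every $U\in SU(4)$) there are an integer $n$ with $0\le n\le 3$ and unitaries $A_0,\dots,A_n,B_0,\dots,B_n\in U(2)$ such that $$U=(A_0\otimes B_0)\,\mathrm{SQiSW}\,(A_1\otimes B_1)\,\mathrm{SQiSW}\cdots\mathrm{SQiSW}\,(A_n\otimes B_n),$$ where $\mathrm{SQiSW}$ occurs exactly $n$ times. -/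

import Mathlib

open scoped Kronecker

/-- Operators on two qubits, in the computational basis: the pair `(i, j)` labels the basis vector
`|i⟩ ⊗ |j⟩`. -/
abbrev TwoQubitMatrix : Type := Matrix (Fin 2 × Fin 2) (Fin 2 × Fin 2) ℂ

/-- The SQiSW gate, the square root of iSWAP. The `4 × 4` matrix is written in the ordered basis
`|00⟩, |01⟩, |10⟩, |11⟩`; `finProdFinEquiv` sends `(i, j)` to `2 * i + j`. -/
noncomputable def SQiSW : TwoQubitMatrix :=
  (!![1, 0, 0, 0;
      0, 1 / (Real.sqrt 2 : ℂ), Complex.I / (Real.sqrt 2 : ℂ), 0;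
      0, Complex.I / (Real.sqrt 2 : ℂ), 1 / (Real.sqrt 2 : ℂ), 0;
      0, 0, 0, 1] : Matrix (Fin 4) (Fin 4) ℂ).submatrix finProdFinEquiv finProdFinEquiv

/-- `IsSQiSWCircuit n U` says that `U` is the operator of a circuit with exactly `n` SQiSW gates
interleaved by single-qubit gates, that is,
`U = (A₀ ⊗ B₀) * SQiSW * (A₁ ⊗ B₁) * SQiSW * ⋯ * SQiSW * (Aₙ ⊗ Bₙ)`
for some unitary `2 × 2` matrices `Aₖ, Bₖ`. -/
inductive IsSQiSWCircuit : ℕ → TwoQubitMatrix → Prop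
  | localGates (A B : Matrix.unitaryGroup (Fin 2) ℂ) :
      IsSQiSWCircuit 0 ((A : Matrix (Fin 2) (Fin 2) ℂ) ⊗ₖ (B : Matrix (Fin 2) (Fin 2) ℂ))
  | step {n : ℕ} {U : TwoQubitMatrix} (hU : IsSQiSWCircuit n U)
      (A B : Matrix.unitaryGroup (Fin 2) ℂ) :
      IsSQiSWCircuit (n + 1)
        (U * SQiSW * ((A : Matrix (Fin 2) (Fin 2) ℂ) ⊗ₖ (B : Matrix (Fin 2) (Fin 2) ℂ)))

/-!
The argument works in the magic basis. There the single-qubit gates `SU(2) ⊗ SU(2)` are exactly the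
rotations `SO(4)`; what is needed is that every rotation is of this form
(`exists_kronecker_of_mem_specialOrthogonalGroup`): `SO(4)` is generated by pairs of reflections,
and a reflection is a product operator composed with the swap of the two qubits.

Two unitaries `V`, `W` of determinant `1` therefore differ by single-qubit gates as soon as the
symmetric unitaries `Vᵀ V` and `Wᵀ W` have the same spectrum. This spectrum is determined by two
invariants, `tr (Vᵀ V)` and `det (1 - Vᵀ V)` (`exists_rotations_of_invariants_eq`). Consequently
every unitary is, up to a phase and single-qubit gates, a canonical gate
`exp (i (x XX + y YY + z ZZ))`, which is diagonal in the magic basis; the order of the coordinates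
`x, y, z` does not matter, and they matter only modulo `π/2`. `SQiSW` itself has the coordinates
`(π/8, π/8, 0)`, which may be permuted and whose signs may be changed.

Two gates: for a rotation `O = G B G` with three real parameters the invariants of `SQiSW · O ·
SQiSW` are computed explicitly. The equations which make them equal to those of a canonical gate can
be solved if `|y| + |z| ≤ |x| ≤ π/4` (`exists_doubleRotation_parameters`, `isSQiSWCircuit_two`).

Three gates: canonical gates commute and multiply by adding coordinates. Splitting off one `SQiSW`
with coordinates `±π/8` in two suitable places moves any point with `|z| ≤ |y| ≤ |x| ≤ π/4` that is
not already reached by two gates into the region above (`isShortCircuit_of_sorted`).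
-/

open Matrix

/-! ### The magic basis -/

/-- The matrix whose columns are `√2` times the vectors of the magic basis
`Φ⁺, iΦ⁻, iΨ⁺, Ψ⁻`, in the ordered computational basis. Leaving out the factor `1 / √2` keeps the
entries Gaussian integers. -/
noncomputable def magicBasis : Matrix (Fin 4) (Fin 4) ℂ :=
  !![1, Complex.I, 0, 0;
     0, 0, Complex.I, 1;
     0, 0, Complex.I, -1;
     1, -Complex.I, 0, 0]

theorem magicBasis_conjTranspose : magicBasisᴴ =
    !![1, 0, 0, 1;
       -Complex.I, 0, 0, Complex.I;
       0, -Complex.I, -Complex.I, 0;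
       0, 1, -1, 0] := by
  ext i j
  fin_cases i <;> fin_cases j <;> simp [magicBasis]

theorem magicBasis_conjTranspose_mul_self : magicBasisᴴ * magicBasis = (2 : ℂ) • 1 := by
  rw [magicBasis_conjTranspose, magicBasis]
  ext i j
  fin_cases i <;> fin_cases j <;>
    simp [Matrix.mul_apply, Fin.sum_univ_four, one_apply] <;> norm_num

theorem magicBasis_mul_conjTranspose_self : magicBasis * magicBasisᴴ = (2 : ℂ) • 1 := by
  rw [magicBasis_conjTranspose, magicBasis]
  ext i j
  fin_cases i <;> fin_cases j <;>
    simp [Matrix.mul_apply, Fin.sum_univ_four, one_apply] <;> norm_num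

/-- The enumeration of the computational basis in the order `|00⟩, |01⟩, |10⟩, |11⟩`. -/
def basisIndex : Fin 2 × Fin 2 ≃ Fin 4 := finProdFinEquiv

theorem basisIndex_zero_zero : basisIndex (0, 0) = 0 := rfl

theorem basisIndex_zero_one : basisIndex (0, 1) = 1 := rfl

theorem basisIndex_one_zero : basisIndex (1, 0) = 2 := rfl

theorem basisIndex_one_one : basisIndex (1, 1) = 3 := rfl

/-- The two-qubit operator whose matrix in the magic basis is `V`. -/
noncomputable def ofMagic (V : Matrix (Fin 4) (Fin 4) ℂ) : TwoQubitMatrix :=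
  ((1 / 2 : ℂ) • (magicBasis * V * magicBasisᴴ)).submatrix basisIndex basisIndex

theorem ofMagic_mul (V W : Matrix (Fin 4) (Fin 4) ℂ) :
    ofMagic (V * W) = ofMagic V * ofMagic W := by
  have h : magicBasis * V * magicBasisᴴ * (magicBasis * W * magicBasisᴴ) =
      (2 : ℂ) • (magicBasis * (V * W) * magicBasisᴴ) := by
    calc _ = magicBasis * V * (magicBasisᴴ * magicBasis) * W * magicBasisᴴ := by
          simp only [Matrix.mul_assoc]
      _ = _ := by
          rw [magicBasis_conjTranspose_mul_self]
          simp [Matrix.mul_assoc]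
  rw [ofMagic, ofMagic, ofMagic, submatrix_mul_equiv, smul_mul_smul_comm, h, smul_smul]
  norm_num

theorem ofMagic_one : ofMagic 1 = 1 := by
  rw [ofMagic, Matrix.mul_one, magicBasis_mul_conjTranspose_self, smul_smul]
  norm_num

theorem ofMagic_smul (a : ℂ) (V : Matrix (Fin 4) (Fin 4) ℂ) :
    ofMagic (a • V) = a • ofMagic V := by
  rw [ofMagic, ofMagic, mul_smul_comm, smul_mul_assoc, smul_comm, submatrix_smul]
  rfl

theorem ofMagic_conjTranspose (V : Matrix (Fin 4) (Fin 4) ℂ) :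
    ofMagic Vᴴ = (ofMagic V)ᴴ := by
  simp [ofMagic, conjTranspose_smul, conjTranspose_mul, Matrix.mul_assoc]

theorem det_ofMagic (V : Matrix (Fin 4) (Fin 4) ℂ) : (ofMagic V).det = V.det := by
  rw [ofMagic, det_submatrix_equiv_self, Matrix.mul_assoc, ← smul_mul_assoc, det_mul_comm,
    mul_smul_comm, Matrix.mul_assoc, magicBasis_conjTranspose_mul_self, mul_smul_comm, smul_smul]
  norm_num

theorem ofMagic_surjective : Function.Surjective ofMagic := by
  intro U
  refine ⟨(1 / 2 : ℂ) • (magicBasisᴴ * U.submatrix basisIndex.symm basisIndex.symm *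
    magicBasis), ?_⟩
  have h : magicBasis * (magicBasisᴴ * U.submatrix basisIndex.symm basisIndex.symm *
      magicBasis) * magicBasisᴴ =
      (4 : ℂ) • U.submatrix basisIndex.symm basisIndex.symm := by
    calc _ = (magicBasis * magicBasisᴴ) * U.submatrix basisIndex.symm basisIndex.symm *
          (magicBasis * magicBasisᴴ) := by simp only [Matrix.mul_assoc]
      _ = _ := by
          rw [magicBasis_mul_conjTranspose_self]
          simp [smul_smul]
          norm_num
  rw [ofMagic, mul_smul_comm, smul_mul_assoc, h, smul_smul, smul_smul]
  norm_num

theorem ofMagic_injective : Function.Injective ofMagic := by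
  intro V W h
  have key : ∀ V, V = (1 / 2 : ℂ) • (magicBasisᴴ *
      (ofMagic V).submatrix basisIndex.symm basisIndex.symm * magicBasis) := by
    intro V
    have h : magicBasisᴴ * (magicBasis * V * magicBasisᴴ) * magicBasis = (4 : ℂ) • V := by
      calc _ = (magicBasisᴴ * magicBasis) * V * (magicBasisᴴ * magicBasis) := by
            simp only [Matrix.mul_assoc]
        _ = _ := by
            rw [magicBasis_conjTranspose_mul_self]
            simp [smul_smul]
            norm_num
    simp only [ofMagic, submatrix_submatrix, Equiv.self_comp_symm, submatrix_id_id, mul_smul_comm,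
      smul_mul_assoc, h, smul_smul]
    norm_num
  rw [key V, key W, h]

theorem ofMagic_mem_unitaryGroup {V : Matrix (Fin 4) (Fin 4) ℂ} :
    ofMagic V ∈ unitaryGroup (Fin 2 × Fin 2) ℂ ↔ V ∈ unitaryGroup (Fin 4) ℂ := by
  rw [mem_unitaryGroup_iff, mem_unitaryGroup_iff, star_eq_conjTranspose, star_eq_conjTranspose,
    ← ofMagic_conjTranspose, ← ofMagic_mul, ← ofMagic_one, ofMagic_injective.eq_iff]

/-- The inclusion of the real `4 × 4` matrices in the complex ones. -/
noncomputable def cplx : Matrix (Fin 4) (Fin 4) ℝ →+* Matrix (Fin 4) (Fin 4) ℂ :=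
  Complex.ofRealHom.mapMatrix

theorem cplx_apply (K : Matrix (Fin 4) (Fin 4) ℝ) (i j : Fin 4) : cplx K i j = (K i j : ℂ) := rfl

theorem det_cplx (K : Matrix (Fin 4) (Fin 4) ℝ) : (cplx K).det = (K.det : ℂ) :=
  (Complex.ofRealHom.map_det K).symm

theorem cplx_transpose (K : Matrix (Fin 4) (Fin 4) ℝ) : cplx Kᵀ = (cplx K)ᵀ := rfl

theorem cplx_conjTranspose (K : Matrix (Fin 4) (Fin 4) ℝ) : (cplx K)ᴴ = (cplx K)ᵀ := by
  ext i j
  simp [cplx_apply]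

/-- The gate exchanging the two qubits. -/
noncomputable def swapGate : TwoQubitMatrix :=
  Matrix.of fun p q => if p.1 = q.2 ∧ p.2 = q.1 then 1 else 0

theorem swapGate_mul_kronecker (A B : Matrix (Fin 2) (Fin 2) ℂ) :
    swapGate * (A ⊗ₖ B) = (B ⊗ₖ A) * swapGate := by
  ext ⟨i, j⟩ ⟨k, l⟩
  fin_cases i <;> fin_cases j <;> fin_cases k <;> fin_cases l <;>
    simp [Matrix.mul_apply, Fintype.sum_prod_type, swapGate, kroneckerMap_apply] <;> ring

theorem swapGate_mul_self : swapGate * swapGate = 1 := by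
  ext ⟨i, j⟩ ⟨k, l⟩
  fin_cases i <;> fin_cases j <;> fin_cases k <;> fin_cases l <;>
    simp [Matrix.mul_apply, Fintype.sum_prod_type, swapGate, one_apply]

theorem ofMagic_apply (V : Matrix (Fin 4) (Fin 4) ℂ) (p q : Fin 2 × Fin 2) :
    ofMagic V p q = 1 / 2 * ∑ k, (∑ j, magicBasis (basisIndex p) j * V j k) *
      magicBasisᴴ k (basisIndex q) := by
  simp only [ofMagic, submatrix_apply, Matrix.smul_apply, smul_eq_mul,
    Matrix.mul_apply]

theorem diagonal_fin_four (a b c d : ℂ) : diagonal ![a, b, c, d] =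
    !![a, 0, 0, 0; 0, b, 0, 0; 0, 0, c, 0; 0, 0, 0, d] := by
  ext i j
  fin_cases i <;> fin_cases j <;> rfl

theorem swapGate_eq_ofMagic : swapGate = ofMagic (diagonal ![1, 1, 1, -1]) := by
  rw [diagonal_fin_four]
  ext ⟨i, j⟩ ⟨k, l⟩
  rw [ofMagic_apply, magicBasis_conjTranspose, magicBasis]
  fin_cases i <;> fin_cases j <;> fin_cases k <;> fin_cases l <;>
    simp [swapGate, Fin.sum_univ_four, basisIndex_zero_zero, basisIndex_zero_one,
      basisIndex_one_zero, basisIndex_one_one] <;> norm_num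

theorem det_swapGate : swapGate.det = -1 := by
  rw [swapGate_eq_ofMagic, det_ofMagic]
  simp [Fin.prod_univ_four]

/-- The quaternion attached to `v ∈ ℝ⁴`, as a `2 × 2` complex matrix of determinant `‖v‖²`. It is
the tensor factor of the reflection orthogonal to `v`; the coordinate `v 3`, along the singlet `Ψ⁻`,
is the real part. -/
noncomputable def reflectionFactor (v : Fin 4 → ℝ) : Matrix (Fin 2) (Fin 2) ℂ :=
  !![v 3 + v 2 * Complex.I, -(v 0 + v 1 * Complex.I);
     v 0 - v 1 * Complex.I, v 3 - v 2 * Complex.I]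

theorem reflectionFactor_conjTranspose (v : Fin 4 → ℝ) : (reflectionFactor v)ᴴ =
  !![v 3 - v 2 * Complex.I, v 0 + v 1 * Complex.I;
     -(v 0 - v 1 * Complex.I), v 3 + v 2 * Complex.I] := by
  ext i j
  fin_cases i <;> fin_cases j <;> simp [reflectionFactor] <;> ring

/-- Identify `v ∈ ℝ⁴` with a `2 × 2` matrix through the magic basis. The reflection in the
hyperplane orthogonal to a unit vector is then `x ↦ -v x̄ v` for quaternions, which is a product
operator up to the exchange of the two factors. -/
theorem ofMagic_reflection (v : Fin 4 → ℝ) (hv : v 0 ^ 2 + v 1 ^ 2 + v 2 ^ 2 + v 3 ^ 2 = 1) :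
    ofMagic (cplx (1 - (2 : ℝ) • vecMulVec v v)) =
      (reflectionFactor v ⊗ₖ (reflectionFactor v)ᴴ) * swapGate := by
  have hv' : (v 0 : ℂ) ^ 2 + (v 1 : ℂ) ^ 2 + (v 2 : ℂ) ^ 2 + (v 3 : ℂ) ^ 2 = 1 := by
    exact_mod_cast hv
  have hI := Complex.I_sq
  have hK : cplx (1 - (2 : ℝ) • vecMulVec v v) =
      !![1 - 2 * (v 0 * v 0 : ℂ), -2 * (v 0 * v 1 : ℂ), -2 * (v 0 * v 2 : ℂ), -2 * (v 0 * v 3 : ℂ);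
        -2 * (v 1 * v 0 : ℂ), 1 - 2 * (v 1 * v 1 : ℂ), -2 * (v 1 * v 2 : ℂ), -2 * (v 1 * v 3 : ℂ);
        -2 * (v 2 * v 0 : ℂ), -2 * (v 2 * v 1 : ℂ), 1 - 2 * (v 2 * v 2 : ℂ), -2 * (v 2 * v 3 : ℂ);
        -2 * (v 3 * v 0 : ℂ), -2 * (v 3 * v 1 : ℂ), -2 * (v 3 * v 2 : ℂ),
          1 - 2 * (v 3 * v 3 : ℂ)] := by
    ext i j
    fin_cases i <;> fin_cases j <;> simp [cplx_apply, vecMulVec_apply, one_apply]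
  have h0 : ∀ p q, (ofMagic (cplx (1 - (2 : ℝ) • vecMulVec v v))) p q =
      ((reflectionFactor v ⊗ₖ (reflectionFactor v)ᴴ) * swapGate) p q := by
    rintro ⟨i, j⟩ ⟨k, l⟩
    rw [hK, reflectionFactor_conjTranspose, reflectionFactor, ofMagic_apply,
      magicBasis_conjTranspose, magicBasis]
    fin_cases i <;> fin_cases j <;> fin_cases k <;> fin_cases l <;>
      simp [swapGate, Matrix.mul_apply, Fintype.sum_prod_type, Fin.sum_univ_four,
        basisIndex_zero_zero, basisIndex_zero_one, basisIndex_one_zero, basisIndex_one_one] <;>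
      grind
  ext p q
  exact h0 p q

theorem SQiSW_eq_ofMagic : SQiSW = ofMagic (diagonal ![1, 1,
    (1 + Complex.I) / (Real.sqrt 2 : ℂ), (1 - Complex.I) / (Real.sqrt 2 : ℂ)]) := by
  have hI := Complex.I_sq
  have h (p q) : SQiSW p q = (!![1, 0, 0, 0;
      0, 1 / (Real.sqrt 2 : ℂ), Complex.I / (Real.sqrt 2 : ℂ), 0;
      0, Complex.I / (Real.sqrt 2 : ℂ), 1 / (Real.sqrt 2 : ℂ), 0;
      0, 0, 0, 1] : Matrix (Fin 4) (Fin 4) ℂ) (basisIndex p) (basisIndex q) := rfl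
  rw [diagonal_fin_four]
  ext ⟨i, j⟩ ⟨k, l⟩
  rw [h, ofMagic_apply, magicBasis_conjTranspose, magicBasis]
  fin_cases i <;> fin_cases j <;> fin_cases k <;> fin_cases l <;>
    simp [Fin.sum_univ_four, basisIndex_zero_zero, basisIndex_zero_one, basisIndex_one_zero,
      basisIndex_one_one] <;> grind

/-! ### Rotations in the magic basis are single-qubit gates -/

/-- The operators `A ⊗ B` with `A, B ∈ SU(2)`, together with their products with the swap gate.
In the magic basis these are the matrices of `O(4)`, the second kind having determinant `-1`. -/
def IsLocalOrSwapped (M : TwoQubitMatrix) : Prop :=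
  ∃ A ∈ specialUnitaryGroup (Fin 2) ℂ, ∃ B ∈ specialUnitaryGroup (Fin 2) ℂ,
    M = A ⊗ₖ B ∨ M = (A ⊗ₖ B) * swapGate

theorem IsLocalOrSwapped.one : IsLocalOrSwapped 1 :=
  ⟨1, one_mem _, 1, one_mem _, Or.inl one_kronecker_one.symm⟩

theorem IsLocalOrSwapped.mul {M N : TwoQubitMatrix} (hM : IsLocalOrSwapped M)
    (hN : IsLocalOrSwapped N) : IsLocalOrSwapped (M * N) := by
  obtain ⟨A, hA, B, hB, hM⟩ := hM
  obtain ⟨C, hC, D, hD, hN⟩ := hN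
  rcases hM with rfl | rfl
  · refine ⟨A * C, mul_mem hA hC, B * D, mul_mem hB hD, ?_⟩
    rcases hN with rfl | rfl
    · exact Or.inl (mul_kronecker_mul ..).symm
    · right
      rw [mul_kronecker_mul, Matrix.mul_assoc]
  · refine ⟨A * D, mul_mem hA hD, B * C, mul_mem hB hC, ?_⟩
    rcases hN with rfl | rfl
    · right
      rw [mul_kronecker_mul, Matrix.mul_assoc, swapGate_mul_kronecker, Matrix.mul_assoc]
    · left
      rw [mul_kronecker_mul, Matrix.mul_assoc, ← Matrix.mul_assoc swapGate,
        swapGate_mul_kronecker, Matrix.mul_assoc, swapGate_mul_self, Matrix.mul_one]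

theorem reflectionFactor_mem (v : Fin 4 → ℝ)
    (hv : v 0 ^ 2 + v 1 ^ 2 + v 2 ^ 2 + v 3 ^ 2 = 1) :
    reflectionFactor v ∈ specialUnitaryGroup (Fin 2) ℂ := by
  have hv' : (v 0 : ℂ) ^ 2 + (v 1 : ℂ) ^ 2 + (v 2 : ℂ) ^ 2 + (v 3 : ℂ) ^ 2 = 1 := by
    exact_mod_cast hv
  have hI := Complex.I_sq
  rw [mem_specialUnitaryGroup_iff, mem_unitaryGroup_iff, star_eq_conjTranspose,
    reflectionFactor_conjTranspose, reflectionFactor]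
  constructor
  · ext i j
    fin_cases i <;> fin_cases j <;> simp [Matrix.mul_apply, Fin.sum_univ_two] <;> grind
  · rw [det_fin_two_of]
    grind

theorem isLocalOrSwapped_reflection (v : Fin 4 → ℝ)
    (hv : v 0 ^ 2 + v 1 ^ 2 + v 2 ^ 2 + v 3 ^ 2 = 1) :
    IsLocalOrSwapped (ofMagic (cplx (1 - (2 : ℝ) • vecMulVec v v))) :=
  ⟨_, reflectionFactor_mem v hv, _,
    (star (⟨_, reflectionFactor_mem v hv⟩ : specialUnitaryGroup (Fin 2) ℂ)).2,
    Or.inr (ofMagic_reflection v hv)⟩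

/-- The matrix of a linear isometry of `ℝ⁴` in the standard basis. -/
noncomputable def isometryMatrix :
    (EuclideanSpace ℝ (Fin 4) ≃ₗᵢ[ℝ] EuclideanSpace ℝ (Fin 4)) →* Matrix (Fin 4) (Fin 4) ℝ :=
  ((toEuclideanCLM (n := Fin 4) (𝕜 := ℝ)).symm.toMulEquiv.toMonoidHom.comp
    (unitary (EuclideanSpace ℝ (Fin 4) →L[ℝ] EuclideanSpace ℝ (Fin 4))).subtype).comp
    Unitary.linearIsometryEquiv.symm.toMonoidHom

theorem isometryMatrix_eq_iff
    (φ : EuclideanSpace ℝ (Fin 4) ≃ₗᵢ[ℝ] EuclideanSpace ℝ (Fin 4))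
    (K : Matrix (Fin 4) (Fin 4) ℝ) :
    isometryMatrix φ = K ↔ ∀ x, toEuclideanCLM (n := Fin 4) (𝕜 := ℝ) K x = φ x := by
  have h : isometryMatrix φ = K ↔ toEuclideanCLM (n := Fin 4) (𝕜 := ℝ) K =
      (φ : EuclideanSpace ℝ (Fin 4) →L[ℝ] EuclideanSpace ℝ (Fin 4)) := by
    rw [eq_comm (a := isometryMatrix φ)]
    exact (toEuclideanCLM (n := Fin 4) (𝕜 := ℝ)).toEquiv.eq_symm_apply
  rw [h, ContinuousLinearMap.ext_iff]
  rfl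

/-- For `v = 0` the reflection is the identity, which is why that case is separate. -/
theorem isLocalOrSwapped_isometryMatrix_reflection (v : EuclideanSpace ℝ (Fin 4)) :
    IsLocalOrSwapped (ofMagic (cplx (isometryMatrix (ℝ ∙ v)ᗮ.reflection))) := by
  by_cases hv : v = 0
  · have h : isometryMatrix (ℝ ∙ v)ᗮ.reflection = 1 := by
      rw [isometryMatrix_eq_iff]
      intro x
      rw [Submodule.reflection_orthogonal_apply, Submodule.reflection_singleton_apply, hv]
      simp
    rw [h, map_one, ofMagic_one]
    exact IsLocalOrSwapped.one
  · have hv0 : ‖v‖ ≠ 0 := norm_ne_zero_iff.2 hv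
    have hn : ‖v‖ ^ 2 = v 0 ^ 2 + v 1 ^ 2 + v 2 ^ 2 + v 3 ^ 2 := by
      simp [EuclideanSpace.norm_sq_eq, Fin.sum_univ_four]
    let w : Fin 4 → ℝ := fun i => v i / ‖v‖
    have hw : w 0 ^ 2 + w 1 ^ 2 + w 2 ^ 2 + w 3 ^ 2 = 1 := by
      simp only [w, div_pow, ← add_div, ← hn]
      exact div_self (pow_ne_zero 2 hv0)
    have h : isometryMatrix (ℝ ∙ v)ᗮ.reflection = 1 - (2 : ℝ) • vecMulVec w w := by
      rw [isometryMatrix_eq_iff]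
      intro x
      ext i
      rw [ofLp_toEuclideanCLM]
      simp [Submodule.reflection_orthogonal_apply, Submodule.reflection_singleton_apply,
        sub_mulVec, smul_mulVec, vecMulVec_mulVec, PiLp.inner_apply, dotProduct,
        Fin.sum_univ_four, w]
      field_simp
    rw [h]
    exact isLocalOrSwapped_reflection w hw

/-- By the Cartan–Dieudonné theorem `O(4)` is generated by reflections. -/
theorem isLocalOrSwapped_of_mem_orthogonalGroup {K : Matrix (Fin 4) (Fin 4) ℝ}
    (hK : K ∈ orthogonalGroup (Fin 4) ℝ) : IsLocalOrSwapped (ofMagic (cplx K)) := by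
  have hu : toEuclideanCLM (n := Fin 4) (𝕜 := ℝ) K ∈
      unitary (EuclideanSpace ℝ (Fin 4) →L[ℝ] EuclideanSpace ℝ (Fin 4)) := Unitary.map_mem _ hK
  have hφ : isometryMatrix (Unitary.linearIsometryEquiv ⟨_, hu⟩) = K :=
    (isometryMatrix_eq_iff _ _).2 fun _ => rfl
  obtain ⟨l, -, hl⟩ := (Unitary.linearIsometryEquiv ⟨_, hu⟩).reflections_generate_dim
  rw [← hφ, hl]
  clear hl
  induction l with
  | nil =>
    rw [List.map_nil, List.prod_nil, map_one, map_one, ofMagic_one]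
    exact IsLocalOrSwapped.one
  | cons v l ih =>
    rw [List.map_cons, List.prod_cons, map_mul, map_mul, ofMagic_mul]
    exact (isLocalOrSwapped_isometryMatrix_reflection v).mul ih

/-- In the magic basis `SO(4)` consists of single-qubit gates: a product of reflections involving
the swap gate has determinant `-1`. -/
theorem exists_kronecker_of_mem_specialOrthogonalGroup {K : Matrix (Fin 4) (Fin 4) ℝ}
    (hK : K ∈ specialOrthogonalGroup (Fin 4) ℝ) :
    ∃ A B : unitaryGroup (Fin 2) ℂ,
      ofMagic (cplx K) = (A : Matrix (Fin 2) (Fin 2) ℂ) ⊗ₖ (B : Matrix (Fin 2) (Fin 2) ℂ) := by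
  obtain ⟨hK, hdet⟩ := mem_specialOrthogonalGroup_iff.1 hK
  obtain ⟨A, hA, B, hB, h | h⟩ := isLocalOrSwapped_of_mem_orthogonalGroup hK
  · exact ⟨⟨A, hA.1⟩, ⟨B, hB.1⟩, h⟩
  · have := congrArg det h
    rw [det_ofMagic, det_cplx, hdet, det_mul, det_kronecker, det_swapGate,
      (mem_specialUnitaryGroup_iff.1 hA).2, (mem_specialUnitaryGroup_iff.1 hB).2] at this
    norm_num at this

namespace IsSQiSWCircuit

variable {n : ℕ} {U : TwoQubitMatrix}

theorem mul_kronecker (hU : IsSQiSWCircuit n U) (A B : unitaryGroup (Fin 2) ℂ) :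
    IsSQiSWCircuit n
      (U * ((A : Matrix (Fin 2) (Fin 2) ℂ) ⊗ₖ (B : Matrix (Fin 2) (Fin 2) ℂ))) := by
  cases hU with
  | localGates C D =>
    rw [← mul_kronecker_mul]
    exact localGates (C * A) (D * B)
  | step hU C D =>
    rw [Matrix.mul_assoc, ← mul_kronecker_mul]
    exact hU.step (C * A) (D * B)

theorem kronecker_mul (hU : IsSQiSWCircuit n U) (A B : unitaryGroup (Fin 2) ℂ) :
    IsSQiSWCircuit n
      (((A : Matrix (Fin 2) (Fin 2) ℂ) ⊗ₖ (B : Matrix (Fin 2) (Fin 2) ℂ)) * U) := by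
  induction hU with
  | localGates C D =>
    rw [← mul_kronecker_mul]
    exact localGates (A * C) (B * D)
  | step hU C D ih =>
    rw [← Matrix.mul_assoc, ← Matrix.mul_assoc]
    exact ih.step C D

/-- A global phase is absorbed by a single-qubit gate. -/
theorem smul (hU : IsSQiSWCircuit n U) {a : ℂ} (ha : a ∈ unitary ℂ) :
    IsSQiSWCircuit n (a • U) := by
  have h : (a • (1 : Matrix (Fin 2) (Fin 2) ℂ)) ∈ unitaryGroup (Fin 2) ℂ := by
    rw [mem_unitaryGroup_iff, star_smul, star_one, smul_mul_smul_comm,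
      Unitary.mul_star_self_of_mem ha]
    simp
  have := hU.mul_kronecker ⟨_, h⟩ 1
  simpa [smul_kronecker] using this

theorem mul_SQiSW (hU : IsSQiSWCircuit n U) : IsSQiSWCircuit (n + 1) (U * SQiSW) := by
  simpa using hU.step 1 1

/-- Rotations in the magic basis are absorbed by the single-qubit gates at the ends of a circuit. -/
theorem ofMagic_rotation_mul_mul {V : Matrix (Fin 4) (Fin 4) ℂ}
    (hV : IsSQiSWCircuit n (ofMagic V)) {K L : Matrix (Fin 4) (Fin 4) ℝ}
    (hK : K ∈ specialOrthogonalGroup (Fin 4) ℝ) (hL : L ∈ specialOrthogonalGroup (Fin 4) ℝ) :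
    IsSQiSWCircuit n (ofMagic (cplx K * V * cplx L)) := by
  obtain ⟨A, B, hAB⟩ := exists_kronecker_of_mem_specialOrthogonalGroup hK
  obtain ⟨C, D, hCD⟩ := exists_kronecker_of_mem_specialOrthogonalGroup hL
  rw [ofMagic_mul, ofMagic_mul, hAB, hCD]
  exact (hV.kronecker_mul A B).mul_kronecker C D

end IsSQiSWCircuit

/-! ### Real diagonalization of symmetric unitary matrices -/

/-- Two commuting real symmetric matrices are diagonal in a common orthonormal basis. -/
theorem exists_orthogonal_simultaneous_diagonal {P Q : Matrix (Fin 4) (Fin 4) ℝ}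
    (hP : P.IsHermitian) (hQ : Q.IsHermitian) (hPQ : Commute P Q) :
    ∃ O ∈ orthogonalGroup (Fin 4) ℝ, ∃ p q : Fin 4 → ℝ,
      P * O = O * diagonal p ∧ Q * O = O * diagonal q := by
  classical
  let A := toEuclideanLin P
  let B := toEuclideanLin Q
  have hA : A.IsSymmetric := isSymmetric_toEuclideanLin_iff.2 hP
  have hB : B.IsSymmetric := isSymmetric_toEuclideanLin_iff.2 hQ
  have hAB : Commute A B := by
    ext x i
    have : P *ᵥ (Q *ᵥ x.ofLp) = Q *ᵥ (P *ᵥ x.ofLp) := by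
      rw [mulVec_mulVec, mulVec_mulVec, hPQ.eq]
    exact congrFun this i
  let W : ℝ × ℝ → Submodule ℝ (EuclideanSpace ℝ (Fin 4)) :=
    fun i => Module.End.eigenspace A i.2 ⊓ Module.End.eigenspace B i.1
  have hW : DirectSum.IsInternal W :=
    LinearMap.IsSymmetric.directSum_isInternal_of_commute hA hB hAB
  -- Only finitely many joint eigenspaces are nonzero, so they have a common orthonormal basis.
  have hfin : Finite {i // W i ≠ ⊥} :=
    (Submodule.finite_ne_bot_of_iSupIndep hW.submodule_iSupIndep).to_subtype
  have := Fintype.ofFinite {i // W i ≠ ⊥}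
  have hW' : DirectSum.IsInternal fun i : {i // W i ≠ ⊥} => W i :=
    DirectSum.isInternal_ne_bot_iff.2 hW
  have hO : OrthogonalFamily ℝ (fun i : {i // W i ≠ ⊥} => W i) fun i => (W i).subtypeₗᵢ :=
    (LinearMap.IsSymmetric.orthogonalFamily_eigenspace_inf_eigenspace hA hB).comp
      Subtype.val_injective
  have hn : Module.finrank ℝ (EuclideanSpace ℝ (Fin 4)) = 4 := by simp
  let b := hW'.subordinateOrthonormalBasis hn hO
  have hb (a : Fin 4) := hW'.subordinateOrthonormalBasis_subordinate hn a hO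
  let idx (a : Fin 4) := (hW'.subordinateOrthonormalBasisIndex hn a hO).1
  refine ⟨(EuclideanSpace.basisFun (Fin 4) ℝ).toBasis.toMatrix b,
    (EuclideanSpace.basisFun (Fin 4) ℝ).toMatrix_orthonormalBasis_mem_unitary b,
    fun a => (idx a).2, fun a => (idx a).1, ?_, ?_⟩
  · ext i a
    have h := congrArg (fun x : EuclideanSpace ℝ (Fin 4) => x i)
      (Module.End.mem_eigenspace_iff.1 (hb a).1)
    rw [mul_diagonal]
    simpa [Module.Basis.toMatrix_apply, Matrix.mul_apply, A, mulVec, dotProduct, b, idx,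
      mul_comm] using h
  · ext i a
    have h := congrArg (fun x : EuclideanSpace ℝ (Fin 4) => x i)
      (Module.End.mem_eigenspace_iff.1 (hb a).2)
    rw [mul_diagonal]
    simpa [Module.Basis.toMatrix_apply, Matrix.mul_apply, B, mulVec, dotProduct, b, idx,
      mul_comm] using h

/-- The real and imaginary parts of a symmetric unitary matrix are commuting symmetric matrices, so
that a real orthogonal matrix diagonalizes it. -/
theorem exists_orthogonal_diagonal_of_symmetric_unitary {W : Matrix (Fin 4) (Fin 4) ℂ}
    (hW : W ∈ unitaryGroup (Fin 4) ℂ) (hs : Wᵀ = W) :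
    ∃ O ∈ orthogonalGroup (Fin 4) ℝ, ∃ d : Fin 4 → ℂ, W * cplx O = cplx O * diagonal d := by
  let P : Matrix (Fin 4) (Fin 4) ℝ := W.map Complex.re
  let Q : Matrix (Fin 4) (Fin 4) ℝ := W.map Complex.im
  have hWPQ : W = cplx P + Complex.I • cplx Q := by
    ext i j
    simp [cplx_apply, P, Q, mul_comm Complex.I]
  have hP : Pᵀ = P := by
    rw [← transpose_map, hs]
  have hQ : Qᵀ = Q := by
    rw [← transpose_map, hs]
  have hstar : star W = cplx P - Complex.I • cplx Q := by
    rw [star_eq_conjTranspose, hWPQ, conjTranspose_add, conjTranspose_smul, cplx_conjTranspose,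
      cplx_conjTranspose, ← cplx_transpose, ← cplx_transpose, hP, hQ]
    simp [sub_eq_add_neg]
  have h1 := mem_unitaryGroup_iff.1 hW
  have h2 := mem_unitaryGroup_iff'.1 hW
  have hcomm : Commute P Q := by
    have h3 : W * star W = star W * W := h1.trans h2.symm
    rw [hstar, hWPQ] at h3
    have h4 : (2 * Complex.I) • (cplx (Q * P) - cplx (P * Q)) = 0 := by
      rw [map_mul, map_mul]
      simp only [Matrix.mul_add, Matrix.add_mul, Matrix.mul_sub, Matrix.sub_mul, smul_mul_assoc,
        mul_smul_comm] at h3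
      rw [← sub_eq_zero] at h3
      rw [← h3, mul_smul, two_smul]
      simp only [smul_sub, smul_add]
      abel
    have h5 := (smul_eq_zero.1 h4).resolve_left (by simp)
    ext i j
    have h6 := congrFun₂ h5 i j
    rw [Matrix.sub_apply, cplx_apply, cplx_apply, Matrix.zero_apply, sub_eq_zero] at h6
    exact_mod_cast h6.symm
  obtain ⟨O, hO, p, q, hp, hq⟩ := exists_orthogonal_simultaneous_diagonal
    (P := P) (Q := Q) (by simpa [IsHermitian] using hP) (by simpa [IsHermitian] using hQ) hcomm
  refine ⟨O, hO, fun i => p i + Complex.I * q i, ?_⟩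
  have hd : diagonal (fun i => (p i + Complex.I * q i : ℂ)) =
      cplx (diagonal p) + Complex.I • cplx (diagonal q) := by
    ext i j
    by_cases h : i = j
    · subst h; simp [cplx_apply]
    · simp [cplx_apply, h]
  rw [hWPQ, hd, Matrix.add_mul, Matrix.mul_add, smul_mul_assoc, mul_smul_comm, ← map_mul,
    ← map_mul, ← map_mul, ← map_mul, hp, hq]

/-- An orthogonal diagonalization can be changed into one by a rotation, because flipping the sign
of an eigenvector changes nothing else. -/
theorem exists_rotation_of_orthogonal_diagonal {W : Matrix (Fin 4) (Fin 4) ℂ}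
    {O : Matrix (Fin 4) (Fin 4) ℝ} (hO : O ∈ orthogonalGroup (Fin 4) ℝ) {d : Fin 4 → ℂ}
    (hd : W * cplx O = cplx O * diagonal d) :
    ∃ R ∈ specialOrthogonalGroup (Fin 4) ℝ, W = cplx R * diagonal d * cplx Rᵀ := by
  have key : ∃ R ∈ specialOrthogonalGroup (Fin 4) ℝ, W * cplx R = cplx R * diagonal d := by
    have hdet : O.det * O.det = 1 := by
      have := congrArg det ((mem_orthogonalGroup_iff _ _).1 hO)
      simpa using this
    rcases mul_self_eq_one_iff.1 hdet with h | h
    · exact ⟨O, mem_specialOrthogonalGroup_iff.2 ⟨hO, h⟩, hd⟩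
    · let S : Matrix (Fin 4) (Fin 4) ℝ := diagonal ![-1, 1, 1, 1]
      have hS : S ∈ orthogonalGroup (Fin 4) ℝ := by
        rw [mem_orthogonalGroup_iff, diagonal_transpose, diagonal_mul_diagonal, ← diagonal_one]
        congr 1
        ext i
        fin_cases i <;> simp
      refine ⟨O * S, mem_specialOrthogonalGroup_iff.2 ⟨mul_mem hO hS, ?_⟩, ?_⟩
      · simp [S, h, Fin.prod_univ_four]
      · have hcS : cplx S = diagonal (fun i => ((![-1, 1, 1, 1] : Fin 4 → ℝ) i : ℂ)) := by
          ext i j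
          by_cases h : i = j
          · subst h; simp [cplx_apply, S]
          · simp [cplx_apply, S, h]
        have hc : diagonal d * cplx S = cplx S * diagonal d := by
          rw [hcS, diagonal_mul_diagonal, diagonal_mul_diagonal]
          simp_rw [mul_comm]
        rw [map_mul, ← Matrix.mul_assoc, hd, Matrix.mul_assoc, hc, ← Matrix.mul_assoc]
  obtain ⟨R, hR, h⟩ := key
  refine ⟨R, hR, ?_⟩
  rw [← h, Matrix.mul_assoc, ← map_mul,
    (mem_orthogonalGroup_iff _ _).1 (mem_specialOrthogonalGroup_iff.1 hR).1, map_one,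
    Matrix.mul_one]

/-! ### Local invariants -/

/-- Four complex numbers of modulus `1` and product `1` are determined, up to order, by their sum
`e₁` and by `∏ (1 - dᵢ)`: the third elementary symmetric function is the conjugate of `e₁`, and
`∏ (1 - dᵢ) = 1 - e₁ + e₂ - e₃ + 1` gives the second. -/
theorem exists_perm_of_sum_eq_of_prod_one_sub_eq {d e : Fin 4 → ℂ}
    (hd : ∀ i, d i * star (d i) = 1) (he : ∀ i, e i * star (e i) = 1)
    (hd1 : ∏ i, d i = 1) (he1 : ∏ i, e i = 1) (hsum : ∑ i, d i = ∑ i, e i)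
    (hprod : ∏ i, (1 - d i) = ∏ i, (1 - e i)) :
    ∃ σ : Equiv.Perm (Fin 4), d ∘ σ = e := by
  have h3 : ∀ f : Fin 4 → ℂ, (∀ i, f i * star (f i) = 1) → ∏ i, f i = 1 →
      star (∑ i, f i) = f 1 * f 2 * f 3 + f 0 * f 2 * f 3 + f 0 * f 1 * f 3 + f 0 * f 1 * f 2 := by
    intro f hf hf1
    have h0 := hf 0
    have h1 := hf 1
    have h2 := hf 2
    have h3 := hf 3
    rw [Fin.prod_univ_four] at hf1
    rw [Fin.sum_univ_four, star_add, star_add, star_add]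
    linear_combination (f 1 * f 2 * f 3) * h0 + (f 0 * f 2 * f 3) * h1 + (f 0 * f 1 * f 3) * h2
      + (f 0 * f 1 * f 2) * h3 - (star (f 0) + star (f 1) + star (f 2) + star (f 3)) * hf1
  have hthree := (h3 d hd hd1).symm.trans ((congrArg star hsum).trans (h3 e he he1))
  rw [Fin.prod_univ_four] at hd1 he1
  rw [Fin.prod_univ_four, Fin.prod_univ_four] at hprod
  rw [Fin.sum_univ_four, Fin.sum_univ_four] at hsum
  open Polynomial in
  have hpoly : ∏ i, (X - C (d i)) = ∏ i, (X - C (e i)) := by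
    have hfour : d 0 * d 1 * d 2 * d 3 = e 0 * e 1 * e 2 * e 3 := hd1.trans he1.symm
    have htwo : d 0 * d 1 + d 0 * d 2 + d 0 * d 3 + d 1 * d 2 + d 1 * d 3 + d 2 * d 3 =
        e 0 * e 1 + e 0 * e 2 + e 0 * e 3 + e 1 * e 2 + e 1 * e 3 + e 2 * e 3 := by
      linear_combination hprod + hsum + hthree - hfour
    have c1 := congrArg C hsum
    have c2 := congrArg C htwo
    have c3 := congrArg C hthree
    have c4 := congrArg C hfour
    simp only [C_add, C_mul] at c1 c2 c3 c4
    rw [Fin.prod_univ_four, Fin.prod_univ_four]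
    linear_combination (-X ^ 3) * c1 + X ^ 2 * c2 - X * c3 + c4
  have hroots := congrArg Polynomial.roots hpoly
  have hr : ∀ f : Fin 4 → ℂ, (∏ i, (Polynomial.X - Polynomial.C (f i))).roots =
      Multiset.map f Finset.univ.val := by
    intro f
    have := Polynomial.roots_multiset_prod_X_sub_C (Multiset.map f Finset.univ.val)
    rwa [Multiset.map_map] at this
  rw [hr, hr] at hroots
  have hfiber : ∀ c, Nonempty ({i // e i = c} ≃ {i // d i = c}) := by
    intro c
    have := congrArg (Multiset.count c) hroots
    rw [Multiset.count_map, Multiset.count_map] at this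
    refine ⟨Fintype.equivOfCardEq ?_⟩
    rw [Fintype.card_subtype, Fintype.card_subtype]
    simpa [Finset.card, eq_comm] using this.symm
  refine ⟨Equiv.ofFiberEquiv fun c => (hfiber c).some, ?_⟩
  ext i
  exact Equiv.ofFiberEquiv_map _ i

theorem cplx_injective : Function.Injective cplx := by
  intro K L h
  ext i j
  have := congrFun₂ h i j
  rw [cplx_apply, cplx_apply] at this
  exact_mod_cast this

/-- A unitary matrix which is also complex orthogonal is real. -/
theorem exists_cplx_eq_of_unitary_of_orthogonal {K : Matrix (Fin 4) (Fin 4) ℂ}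
    (hK : K ∈ unitaryGroup (Fin 4) ℂ) (hKt : Kᵀ * K = 1) (hdet : K.det = 1) :
    ∃ R ∈ specialOrthogonalGroup (Fin 4) ℝ, cplx R = K := by
  have h1 : K * star K = 1 := mem_unitaryGroup_iff.1 hK
  have h : Kᵀ = star K := by
    calc Kᵀ = Kᵀ * (K * star K) := by rw [h1, Matrix.mul_one]
      _ = star K := by rw [← Matrix.mul_assoc, hKt, Matrix.one_mul]
  have hre : cplx (K.map Complex.re) = K := by
    ext i j
    have := congrFun₂ h j i
    rw [transpose_apply, star_apply] at this
    exact Complex.conj_eq_iff_re.1 this.symm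
  refine ⟨K.map Complex.re, mem_specialOrthogonalGroup_iff.2 ⟨?_, ?_⟩, hre⟩
  · rw [mem_orthogonalGroup_iff']
    apply cplx_injective
    rw [map_mul, cplx_transpose, hre, hKt, map_one]
  · have := det_cplx (K.map Complex.re)
    rw [hre, hdet] at this
    exact_mod_cast this.symm

theorem transpose_mul_self_mem_unitaryGroup {V : Matrix (Fin 4) (Fin 4) ℂ}
    (hV : V ∈ unitaryGroup (Fin 4) ℂ) : Vᵀ * V ∈ unitaryGroup (Fin 4) ℂ :=
  mul_mem (transpose_mem_unitaryGroup_iff.2 hV) hV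

theorem cplx_mem_unitaryGroup {R : Matrix (Fin 4) (Fin 4) ℝ}
    (hR : R ∈ specialOrthogonalGroup (Fin 4) ℝ) : cplx R ∈ unitaryGroup (Fin 4) ℂ := by
  rw [mem_unitaryGroup_iff, star_eq_conjTranspose, cplx_conjTranspose, ← cplx_transpose, ← map_mul,
    (mem_orthogonalGroup_iff _ _).1 (mem_specialOrthogonalGroup_iff.1 hR).1, map_one]

theorem cplx_mul_cplx_transpose {R : Matrix (Fin 4) (Fin 4) ℝ}
    (hR : R ∈ specialOrthogonalGroup (Fin 4) ℝ) : cplx R * cplx Rᵀ = 1 := by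
  rw [← map_mul, (mem_orthogonalGroup_iff _ _).1 (mem_specialOrthogonalGroup_iff.1 hR).1, map_one]

theorem cplx_transpose_mul_cplx {R : Matrix (Fin 4) (Fin 4) ℝ}
    (hR : R ∈ specialOrthogonalGroup (Fin 4) ℝ) : cplx Rᵀ * cplx R = 1 := by
  rw [← map_mul, (mem_orthogonalGroup_iff' _ _).1 (mem_specialOrthogonalGroup_iff.1 hR).1, map_one]

theorem transpose_mem_specialOrthogonalGroup {R : Matrix (Fin 4) (Fin 4) ℝ}
    (hR : R ∈ specialOrthogonalGroup (Fin 4) ℝ) : Rᵀ ∈ specialOrthogonalGroup (Fin 4) ℝ := by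
  obtain ⟨h, hd⟩ := mem_specialOrthogonalGroup_iff.1 hR
  refine mem_specialOrthogonalGroup_iff.2 ⟨?_, by rw [det_transpose, hd]⟩
  rw [mem_orthogonalGroup_iff, transpose_transpose]
  exact (mem_orthogonalGroup_iff' _ _).1 h

/-- The spectrum of `Vᵀ V`, through which the local invariants of `V` are read. -/
theorem exists_rotation_diagonal {V : Matrix (Fin 4) (Fin 4) ℂ}
    (hV : V ∈ unitaryGroup (Fin 4) ℂ) (hdet : V.det = 1) :
    ∃ R ∈ specialOrthogonalGroup (Fin 4) ℝ, ∃ d : Fin 4 → ℂ,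
      Vᵀ * V = cplx R * diagonal d * cplx Rᵀ ∧ (∀ i, d i * star (d i) = 1) ∧ ∏ i, d i = 1 ∧
      (Vᵀ * V).trace = ∑ i, d i ∧ (1 - Vᵀ * V).det = ∏ i, (1 - d i) := by
  have hu := transpose_mul_self_mem_unitaryGroup hV
  obtain ⟨O, hO, d, hd⟩ := exists_orthogonal_diagonal_of_symmetric_unitary hu (by simp)
  obtain ⟨R, hR, h⟩ := exists_rotation_of_orthogonal_diagonal hO hd
  have h1 := cplx_transpose_mul_cplx hR
  have h2 := cplx_mul_cplx_transpose hR
  have hRd : (cplx R).det = 1 := by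
    rw [det_cplx, (mem_specialOrthogonalGroup_iff.1 hR).2, Complex.ofReal_one]
  have hRd' : (cplx Rᵀ).det = 1 := by rw [cplx_transpose, det_transpose, hRd]
  refine ⟨R, hR, d, h, ?_, ?_, ?_, ?_⟩
  · have hD : diagonal d ∈ unitaryGroup (Fin 4) ℂ := by
      have : diagonal d = cplx Rᵀ * (Vᵀ * V) * cplx R := by
        rw [h]
        simp only [Matrix.mul_assoc, h1, Matrix.mul_one]
        rw [← Matrix.mul_assoc, h1, Matrix.one_mul]
      rw [this]
      exact mul_mem (mul_mem (cplx_mem_unitaryGroup (transpose_mem_specialOrthogonalGroup hR)) hu)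
        (cplx_mem_unitaryGroup hR)
    intro i
    have := congrFun₂ (mem_unitaryGroup_iff.1 hD) i i
    simpa [star_eq_conjTranspose, diagonal_conjTranspose, diagonal_mul_diagonal] using this
  · have := congrArg det h
    rw [det_mul, det_mul, det_mul, det_transpose, hdet, hRd, hRd', det_diagonal] at this
    simpa using this.symm
  · rw [h, trace_mul_comm, ← Matrix.mul_assoc, h1, Matrix.one_mul, trace_diagonal]
  · have : 1 - Vᵀ * V = cplx R * diagonal (fun i => 1 - d i) * cplx Rᵀ := by
      have h3 : diagonal (fun i => 1 - d i) = 1 - diagonal d := by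
        rw [← diagonal_one, diagonal_sub]
      rw [h3, Matrix.mul_sub, Matrix.sub_mul, Matrix.mul_one, h2, h]
    rw [this, det_mul, det_mul, hRd, hRd', det_diagonal]
    simp

/-- The trace of `Vᵀ V` and `det (1 - Vᵀ V)` determine `V` up to multiplication by rotations on both
sides. They determine the spectrum of `Vᵀ V`, hence a rotation `L` with `Lᵀ Vᵀ V L = Wᵀ W`; then
`W (V L)⁻¹` is both unitary and complex orthogonal, hence real. -/
theorem exists_rotations_of_invariants_eq {V W : Matrix (Fin 4) (Fin 4) ℂ}
    (hV : V ∈ unitaryGroup (Fin 4) ℂ) (hW : W ∈ unitaryGroup (Fin 4) ℂ)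
    (hVdet : V.det = 1) (hWdet : W.det = 1) (htr : (Vᵀ * V).trace = (Wᵀ * W).trace)
    (hdet : (1 - Vᵀ * V).det = (1 - Wᵀ * W).det) :
    ∃ K ∈ specialOrthogonalGroup (Fin 4) ℝ, ∃ L ∈ specialOrthogonalGroup (Fin 4) ℝ,
      W = cplx K * V * cplx L := by
  obtain ⟨R, hR, d, hVd, hd, hd1, hdtr, hddet⟩ := exists_rotation_diagonal hV hVdet
  obtain ⟨S, hS, e, hWe, he, he1, hetr, hedet⟩ := exists_rotation_diagonal hW hWdet
  obtain ⟨σ, rfl⟩ := exists_perm_of_sum_eq_of_prod_one_sub_eq hd he hd1 he1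
    (by rw [← hdtr, ← hetr, htr]) (by rw [← hddet, ← hedet, hdet])
  -- Permuting the columns of `R` may change the sign of its determinant.
  have hRσ : R.submatrix id σ ∈ orthogonalGroup (Fin 4) ℝ := by
    rw [mem_orthogonalGroup_iff, transpose_submatrix, submatrix_mul_equiv,
      (mem_orthogonalGroup_iff _ _).1 (mem_specialOrthogonalGroup_iff.1 hR).1, submatrix_id_id]
  have hcRσ : cplx (R.submatrix id σ) = (cplx R).submatrix id σ := rfl
  have hmul : Vᵀ * V * cplx (R.submatrix id σ) = cplx (R.submatrix id σ) * diagonal (d ∘ σ) := by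
    have h : Vᵀ * V * cplx R = cplx R * diagonal d := by
      rw [hVd, Matrix.mul_assoc, cplx_transpose_mul_cplx hR, Matrix.mul_one]
    ext i j
    rw [mul_diagonal, hcRσ]
    have := congrFun₂ h i (σ j)
    rw [mul_diagonal] at this
    exact this
  obtain ⟨R', hR', hVR'⟩ := exists_rotation_of_orthogonal_diagonal hRσ hmul
  let L := R' * Sᵀ
  have hL : L ∈ specialOrthogonalGroup (Fin 4) ℝ :=
    mul_mem hR' (transpose_mem_specialOrthogonalGroup hS)
  have hWL : cplx L * (Wᵀ * W) * cplx Lᵀ = Vᵀ * V := by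
    rw [hWe, hVR']
    have hLS : cplx L * cplx S = cplx R' := by
      rw [← map_mul, Matrix.mul_assoc,
        (mem_orthogonalGroup_iff' _ _).1 (mem_specialOrthogonalGroup_iff.1 hS).1, Matrix.mul_one]
    have hSL : cplx Sᵀ * cplx Lᵀ = cplx R'ᵀ := by
      rw [← map_mul, ← transpose_mul, cplx_transpose, map_mul, hLS, cplx_transpose]
    rw [← hLS, ← hSL]
    simp only [Matrix.mul_assoc]
  have hVs : V * star V = 1 := mem_unitaryGroup_iff.1 hV
  have hVs' : star V * V = 1 := mem_unitaryGroup_iff'.1 hV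
  let K := W * cplx Lᵀ * star V
  have hK : K ∈ unitaryGroup (Fin 4) ℂ :=
    mul_mem (mul_mem hW (cplx_mem_unitaryGroup (transpose_mem_specialOrthogonalGroup hL)))
      (Unitary.star_mem hV)
  have hKt : Kᵀ * K = 1 := by
    have : Kᵀ * K = (star V)ᵀ * (cplx L * (Wᵀ * W) * cplx Lᵀ) * star V := by
      simp only [K, transpose_mul, cplx_transpose, transpose_transpose, Matrix.mul_assoc]
    rw [this, hWL, Matrix.mul_assoc, Matrix.mul_assoc, hVs, Matrix.mul_one, ← transpose_mul, hVs,
      transpose_one]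
  have hKdet : K.det = 1 := by
    have h1 : (star V).det = 1 := by
      have := congrArg det hVs
      rwa [det_mul, hVdet, one_mul, det_one] at this
    rw [det_mul, det_mul, hWdet, h1, det_cplx, det_transpose,
      (mem_specialOrthogonalGroup_iff.1 hL).2]
    simp
  obtain ⟨K', hK', hKK'⟩ := exists_cplx_eq_of_unitary_of_orthogonal hK hKt hKdet
  refine ⟨K', hK', L, hL, ?_⟩
  rw [hKK', Matrix.mul_assoc (W * cplx Lᵀ), hVs', Matrix.mul_one, Matrix.mul_assoc,
    cplx_transpose_mul_cplx hL, Matrix.mul_one]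

theorem IsSQiSWCircuit.of_invariants_eq {n : ℕ} {V W : Matrix (Fin 4) (Fin 4) ℂ}
    (hV : V ∈ unitaryGroup (Fin 4) ℂ) (hW : W ∈ unitaryGroup (Fin 4) ℂ)
    (hVdet : V.det = 1) (hWdet : W.det = 1) (htr : (Vᵀ * V).trace = (Wᵀ * W).trace)
    (hdet : (1 - Vᵀ * V).det = (1 - Wᵀ * W).det) (h : IsSQiSWCircuit n (ofMagic V)) :
    IsSQiSWCircuit n (ofMagic W) := by
  obtain ⟨K, hK, L, hL, rfl⟩ := exists_rotations_of_invariants_eq hV hW hVdet hWdet htr hdet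
  exact h.ofMagic_rotation_mul_mul hK hL

/-! ### Canonical gates -/

/-- The matrix in the magic basis of the canonical gate `exp (i (x XX + y YY + z ZZ))`, where `X`,
`Y`, `Z` are the Pauli matrices: the magic basis diagonalizes `XX`, `YY` and `ZZ`. -/
noncomputable def canonicalGate (x y z : ℝ) : Matrix (Fin 4) (Fin 4) ℂ :=
  diagonal ![Complex.exp ((x - y + z) * Complex.I), Complex.exp ((-x + y + z) * Complex.I),
    Complex.exp ((x + y - z) * Complex.I), Complex.exp ((-x - y - z) * Complex.I)]

theorem canonicalGate_mul (x y z x' y' z' : ℝ) :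
    canonicalGate x y z * canonicalGate x' y' z' = canonicalGate (x + x') (y + y') (z + z') := by
  rw [canonicalGate, canonicalGate, canonicalGate, diagonal_mul_diagonal]
  congr 1
  ext i
  fin_cases i <;> simp [← Complex.exp_add] <;> congr 1 <;> ring

theorem canonicalGate_zero : canonicalGate 0 0 0 = 1 := by
  rw [canonicalGate, ← diagonal_one]
  congr 1
  ext i
  fin_cases i <;> simp

theorem star_canonicalGate (x y z : ℝ) :
    star (canonicalGate x y z) = canonicalGate (-x) (-y) (-z) := by
  rw [canonicalGate, canonicalGate, star_eq_conjTranspose, diagonal_conjTranspose]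
  congr 1
  ext i
  fin_cases i <;> simp [← Complex.exp_conj] <;> congr 1 <;> ring

theorem canonicalGate_mem_unitaryGroup (x y z : ℝ) :
    canonicalGate x y z ∈ unitaryGroup (Fin 4) ℂ := by
  rw [mem_unitaryGroup_iff, star_canonicalGate, canonicalGate_mul, ← canonicalGate_zero]
  simp

theorem det_canonicalGate (x y z : ℝ) : (canonicalGate x y z).det = 1 := by
  rw [canonicalGate, det_diagonal, Fin.prod_univ_four]
  simp only [cons_val, ← Complex.exp_add]
  rw [← Complex.exp_zero]
  congr 1
  ring

theorem canonicalGate_transpose_mul_self (x y z : ℝ) :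
    (canonicalGate x y z)ᵀ * canonicalGate x y z = canonicalGate (2 * x) (2 * y) (2 * z) := by
  rw [canonicalGate, diagonal_transpose, ← canonicalGate, canonicalGate_mul, two_mul, two_mul,
    two_mul]

theorem canonicalGate_eq (x y z : ℝ) : canonicalGate x y z = diagonal
    ![Complex.exp (x * Complex.I) * (Complex.exp (y * Complex.I))⁻¹ * Complex.exp (z * Complex.I),
      (Complex.exp (x * Complex.I))⁻¹ * Complex.exp (y * Complex.I) * Complex.exp (z * Complex.I),
      Complex.exp (x * Complex.I) * Complex.exp (y * Complex.I) * (Complex.exp (z * Complex.I))⁻¹,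
      (Complex.exp (x * Complex.I))⁻¹ * (Complex.exp (y * Complex.I))⁻¹ *
        (Complex.exp (z * Complex.I))⁻¹] := by
  rw [canonicalGate]
  congr 1
  ext i
  fin_cases i <;> simp [← Complex.exp_add, ← Complex.exp_neg] <;> congr 1 <;> ring

theorem ofReal_cos_eq (t : ℝ) : (Real.cos t : ℂ) =
    (Complex.exp (t * Complex.I) + (Complex.exp (t * Complex.I))⁻¹) / 2 := by
  rw [Complex.ofReal_cos, Complex.cos, ← Complex.exp_neg, neg_mul]

theorem ofReal_sin_eq (t : ℝ) : (Real.sin t : ℂ) =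
    ((Complex.exp (t * Complex.I))⁻¹ - Complex.exp (t * Complex.I)) * Complex.I / 2 := by
  rw [Complex.ofReal_sin, Complex.sin, ← Complex.exp_neg, neg_mul]

theorem trace_canonicalGate (x y z : ℝ) : (canonicalGate x y z).trace =
    4 * (Real.cos x * Real.cos y * Real.cos z : ℂ) +
      4 * (Real.sin x * Real.sin y * Real.sin z : ℂ) * Complex.I := by
  rw [canonicalGate_eq, trace_diagonal, Fin.sum_univ_four]
  simp only [cons_val, ofReal_cos_eq, ofReal_sin_eq]
  have hI : Complex.I ^ 4 = 1 := Complex.I_pow_four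
  have hx := Complex.exp_ne_zero (x * Complex.I)
  have hy := Complex.exp_ne_zero (y * Complex.I)
  have hz := Complex.exp_ne_zero (z * Complex.I)
  generalize Complex.exp (x * Complex.I) = a at *
  generalize Complex.exp (y * Complex.I) = b at *
  generalize Complex.exp (z * Complex.I) = c at *
  linear_combination (-1 / 2) * (a⁻¹ - a) * (b⁻¹ - b) * (c⁻¹ - c) * hI

theorem det_one_sub_canonicalGate (x y z : ℝ) : (1 - canonicalGate x y z).det =
    4 * ((Real.cos x ^ 2 + Real.cos y ^ 2 + Real.cos z ^ 2 -
      2 * Real.cos x * Real.cos y * Real.cos z - 1 : ℝ) : ℂ) := by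
  rw [canonicalGate_eq, ← diagonal_one, diagonal_sub, det_diagonal, Fin.prod_univ_four]
  push_cast
  rw [← Complex.ofReal_cos, ← Complex.ofReal_cos, ← Complex.ofReal_cos]
  simp only [ofReal_cos_eq]
  have hx := Complex.exp_ne_zero (x * Complex.I)
  have hy := Complex.exp_ne_zero (y * Complex.I)
  have hz := Complex.exp_ne_zero (z * Complex.I)
  generalize Complex.exp (x * Complex.I) = a at *
  generalize Complex.exp (y * Complex.I) = b at *
  generalize Complex.exp (z * Complex.I) = c at *
  field_simp
  ring

theorem SQiSW_eq_ofMagic_canonicalGate :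
    SQiSW = ofMagic (canonicalGate (Real.pi / 8) (Real.pi / 8) 0) := by
  have h2 : (Real.sqrt 2 : ℂ) * (Real.sqrt 2 : ℂ) = 2 := by
    rw [← Complex.ofReal_mul, Real.mul_self_sqrt (by norm_num)]; norm_num
  have h0 : (Real.sqrt 2 : ℂ) ≠ 0 := by
    intro h; rw [h] at h2; norm_num at h2
  have h1 : Complex.exp ((Real.pi / 4 : ℝ) * Complex.I) = (1 + Complex.I) / (Real.sqrt 2 : ℂ) := by
    rw [Complex.exp_mul_I, ← Complex.ofReal_cos, ← Complex.ofReal_sin, Real.cos_pi_div_four,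
      Real.sin_pi_div_four]
    push_cast
    field_simp
    linear_combination (1 + Complex.I) * h2
  have h3 : Complex.exp ((-(Real.pi / 4) : ℝ) * Complex.I) =
      (1 - Complex.I) / (Real.sqrt 2 : ℂ) := by
    rw [Complex.exp_mul_I, ← Complex.ofReal_cos, ← Complex.ofReal_sin, Real.cos_neg, Real.sin_neg,
      Real.cos_pi_div_four, Real.sin_pi_div_four]
    push_cast
    field_simp
    linear_combination (1 - Complex.I) * h2
  rw [SQiSW_eq_ofMagic, canonicalGate, ← h1, ← h3]
  congr 2
  ext i
  fin_cases i <;> simp <;> congr 1 <;> ring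

/-- Canonical gates with the same local invariants have circuits of the same lengths. In particular
the order of `x, y, z` does not matter. -/
theorem IsSQiSWCircuit.canonicalGate_congr {n : ℕ} {x y z x' y' z' : ℝ}
    (hc : Real.cos (2 * x) * Real.cos (2 * y) * Real.cos (2 * z) =
      Real.cos (2 * x') * Real.cos (2 * y') * Real.cos (2 * z'))
    (hs : Real.sin (2 * x) * Real.sin (2 * y) * Real.sin (2 * z) =
      Real.sin (2 * x') * Real.sin (2 * y') * Real.sin (2 * z'))
    (hsq : Real.cos (2 * x) ^ 2 + Real.cos (2 * y) ^ 2 + Real.cos (2 * z) ^ 2 =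
      Real.cos (2 * x') ^ 2 + Real.cos (2 * y') ^ 2 + Real.cos (2 * z') ^ 2)
    (h : IsSQiSWCircuit n (ofMagic (canonicalGate x y z))) :
    IsSQiSWCircuit n (ofMagic (canonicalGate x' y' z')) := by
  refine h.of_invariants_eq (canonicalGate_mem_unitaryGroup ..) (canonicalGate_mem_unitaryGroup ..)
    (det_canonicalGate ..) (det_canonicalGate ..) ?_ ?_
  · rw [canonicalGate_transpose_mul_self, canonicalGate_transpose_mul_self, trace_canonicalGate,
      trace_canonicalGate]
    have hc' := congrArg Complex.ofReal hc
    have hs' := congrArg Complex.ofReal hs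
    simp only [Complex.ofReal_mul] at hc' hs'
    rw [hc', hs']
  · rw [canonicalGate_transpose_mul_self, canonicalGate_transpose_mul_self,
      det_one_sub_canonicalGate, det_one_sub_canonicalGate]
    congr 2
    linear_combination hsq - 2 * hc

/-! ### Rotations used in two-gate circuits -/

theorem isSQiSWCircuit_one : IsSQiSWCircuit 0 1 := by
  simpa using IsSQiSWCircuit.localGates 1 1

/-- The rotation of `ℝ⁴` by the angle with cosine `g` and sine `h` in the plane of the last two
coordinates. -/
def lastPlaneRotation (g h : ℝ) : Matrix (Fin 4) (Fin 4) ℝ :=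
  !![1, 0, 0, 0; 0, 1, 0, 0; 0, 0, g, -h; 0, 0, h, g]

/-- The rotation of `ℝ⁴` by the angle with cosine `p` and sine `p'` in the plane of the coordinates
`0, 2` and by the angle with cosine `q` and sine `q'` in the plane of the coordinates `1, 3`. -/
def doubleRotation (p p' q q' : ℝ) : Matrix (Fin 4) (Fin 4) ℝ :=
  !![p, 0, -p', 0; 0, q, 0, -q'; p', 0, p, 0; 0, q', 0, q]

theorem cplx_lastPlaneRotation (g h : ℝ) : cplx (lastPlaneRotation g h) =
    !![1, 0, 0, 0; 0, 1, 0, 0; 0, 0, (g : ℂ), -(h : ℂ); 0, 0, (h : ℂ), (g : ℂ)] := by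
  ext i j
  fin_cases i <;> fin_cases j <;> simp [lastPlaneRotation, cplx_apply]

theorem cplx_lastPlaneRotation_transpose (g h : ℝ) : cplx (lastPlaneRotation g h)ᵀ =
    !![1, 0, 0, 0; 0, 1, 0, 0; 0, 0, (g : ℂ), (h : ℂ); 0, 0, -(h : ℂ), (g : ℂ)] := by
  ext i j
  fin_cases i <;> fin_cases j <;> simp [lastPlaneRotation, cplx_apply]

theorem cplx_doubleRotation (p p' q q' : ℝ) : cplx (doubleRotation p p' q q') =
    !![(p : ℂ), 0, -(p' : ℂ), 0; 0, (q : ℂ), 0, -(q' : ℂ); (p' : ℂ), 0, (p : ℂ), 0;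
      0, (q' : ℂ), 0, (q : ℂ)] := by
  ext i j
  fin_cases i <;> fin_cases j <;> simp [doubleRotation, cplx_apply]

theorem cplx_doubleRotation_transpose (p p' q q' : ℝ) : cplx (doubleRotation p p' q q')ᵀ =
    !![(p : ℂ), 0, (p' : ℂ), 0; 0, (q : ℂ), 0, (q' : ℂ); -(p' : ℂ), 0, (p : ℂ), 0;
      0, -(q' : ℂ), 0, (q : ℂ)] := by
  ext i j
  fin_cases i <;> fin_cases j <;> simp [doubleRotation, cplx_apply]

theorem lastPlaneRotation_mem {g h : ℝ} (hgh : g ^ 2 + h ^ 2 = 1) :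
    lastPlaneRotation g h ∈ specialOrthogonalGroup (Fin 4) ℝ := by
  rw [mem_specialOrthogonalGroup_iff, mem_orthogonalGroup_iff]
  constructor
  · ext i j
    fin_cases i <;> fin_cases j <;>
      simp [lastPlaneRotation, Matrix.mul_apply, Fin.sum_univ_four] <;> linarith
  · simp [lastPlaneRotation, det_succ_row_zero, Fin.sum_univ_succ]
    linarith

theorem doubleRotation_mem {p p' q q' : ℝ} (hp : p ^ 2 + p' ^ 2 = 1) (hq : q ^ 2 + q' ^ 2 = 1) :
    doubleRotation p p' q q' ∈ specialOrthogonalGroup (Fin 4) ℝ := by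
  rw [mem_specialOrthogonalGroup_iff, mem_orthogonalGroup_iff]
  constructor
  · ext i j
    fin_cases i <;> fin_cases j <;>
      simp [doubleRotation, Matrix.mul_apply, Fin.sum_univ_four] <;> linarith
  · simp [doubleRotation, det_succ_row_zero, Fin.sum_univ_succ, Fin.succAbove]
    linear_combination (q ^ 2 + q' ^ 2) * hp + hq

/-- The square of the gate `SQiSW`, that is iSWAP, in the magic basis. -/
theorem canonicalGate_iSWAP : canonicalGate (Real.pi / 4) (Real.pi / 4) 0 =
    !![1, 0, 0, 0; 0, 1, 0, 0; 0, 0, Complex.I, 0; 0, 0, 0, -Complex.I] := by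
  have h1 : Complex.exp ((Real.pi / 4 + Real.pi / 4) * Complex.I) = Complex.I :=
    (congrArg Complex.exp (by ring)).trans Complex.exp_pi_div_two_mul_I
  have h2 : Complex.exp ((-(Real.pi / 4) - Real.pi / 4) * Complex.I) = -Complex.I :=
    (congrArg Complex.exp (by ring)).trans Complex.exp_neg_pi_div_two_mul_I
  rw [canonicalGate, ← diagonal_fin_four]
  congr 1
  ext i
  fin_cases i
  · simp
  · simp
  · simpa using h1
  · simpa using h2

/-- The identity on the plane of the coordinates `0, 1`, and `i` times a reflection, for
`c ^ 2 + s ^ 2 = 1`, on the plane of the coordinates `2, 3`. These are the conjugates of iSWAP by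
rotations of the latter plane. -/
noncomputable def reflectedISWAP (c s : ℝ) : Matrix (Fin 4) (Fin 4) ℂ :=
  !![1, 0, 0, 0; 0, 1, 0, 0; 0, 0, c * Complex.I, s * Complex.I;
    0, 0, s * Complex.I, -c * Complex.I]

theorem lastPlaneRotation_mul_iSWAP_mul_transpose (g h : ℝ) :
    cplx (lastPlaneRotation g h) * canonicalGate (Real.pi / 4) (Real.pi / 4) 0 *
      cplx (lastPlaneRotation g h)ᵀ = reflectedISWAP (g ^ 2 - h ^ 2) (2 * g * h) := by
  rw [canonicalGate_iSWAP, cplx_lastPlaneRotation, cplx_lastPlaneRotation_transpose]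
  ext i j
  fin_cases i <;> fin_cases j <;>
    simp [reflectedISWAP, Matrix.mul_apply, Fin.sum_univ_four] <;>
    ring

theorem transpose_mul_iSWAP_mul_lastPlaneRotation (g h : ℝ) :
    cplx (lastPlaneRotation g h)ᵀ * canonicalGate (Real.pi / 4) (Real.pi / 4) 0 *
      cplx (lastPlaneRotation g h) = reflectedISWAP (g ^ 2 - h ^ 2) (-(2 * g * h)) := by
  rw [canonicalGate_iSWAP, cplx_lastPlaneRotation, cplx_lastPlaneRotation_transpose]
  ext i j
  fin_cases i <;> fin_cases j <;>
    simp [reflectedISWAP, Matrix.mul_apply, Fin.sum_univ_four] <;>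
    ring

theorem trace_reflectedISWAP_mul {p p' q q' c s : ℝ} (hcs : c ^ 2 + s ^ 2 = 1) :
    (reflectedISWAP c s * (cplx (doubleRotation p p' q q')ᵀ * reflectedISWAP c (-s) *
      cplx (doubleRotation p p' q q'))).trace =
      ((s ^ 2 * (p + q) ^ 2 : ℝ) : ℂ) + ((2 * c * (p' ^ 2 - q' ^ 2) : ℝ) : ℂ) * Complex.I := by
  have hI := Complex.I_sq
  have hcs' : (c : ℂ) ^ 2 + (s : ℂ) ^ 2 = 1 := by exact_mod_cast hcs
  rw [cplx_doubleRotation, cplx_doubleRotation_transpose]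
  simp [trace, Fin.sum_univ_four, reflectedISWAP]
  linear_combination (c ^ 2 * (p ^ 2 + q ^ 2) - 2 * s ^ 2 * p * q : ℂ) * hI
    - (p ^ 2 + q ^ 2 : ℂ) * hcs'

theorem det_one_sub_reflectedISWAP_mul {p p' q q' c s : ℝ} (hp : p ^ 2 + p' ^ 2 = 1)
    (hq : q ^ 2 + q' ^ 2 = 1) (hcs : c ^ 2 + s ^ 2 = 1) :
    (1 - reflectedISWAP c s * (cplx (doubleRotation p p' q q')ᵀ * reflectedISWAP c (-s) *
      cplx (doubleRotation p p' q q'))).det = ((4 * p' ^ 2 * q' ^ 2 : ℝ) : ℂ) := by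
  have hI := Complex.I_sq
  have hcs' : (c : ℂ) ^ 2 + (s : ℂ) ^ 2 = 1 := by exact_mod_cast hcs
  have hB := doubleRotation_mem hp hq
  have hinv : reflectedISWAP c s * reflectedISWAP (-c) (-s) = 1 := by
    ext i j
    fin_cases i <;> fin_cases j <;>
      simp [reflectedISWAP, Matrix.mul_apply, Fin.sum_univ_four] <;> grind
  have hdet : (reflectedISWAP c s).det = 1 := by
    simp [reflectedISWAP, det_succ_row_zero, Fin.sum_univ_succ]
    grind
  -- Multiplying by `F⁻¹` on the left and `Bᵀ` on the right makes a diagonal block vanish.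
  have hfac : 1 - reflectedISWAP c s * (cplx (doubleRotation p p' q q')ᵀ * reflectedISWAP c (-s) *
      cplx (doubleRotation p p' q q')) =
      reflectedISWAP c s * (reflectedISWAP (-c) (-s) * cplx (doubleRotation p p' q q')ᵀ -
        cplx (doubleRotation p p' q q')ᵀ * reflectedISWAP c (-s)) *
        cplx (doubleRotation p p' q q') := by
    rw [Matrix.mul_sub, Matrix.sub_mul, 
      ← Matrix.mul_assoc (reflectedISWAP c s) (reflectedISWAP (-c) (-s)), hinv, Matrix.one_mul,
      cplx_transpose_mul_cplx hB]
    simp only [Matrix.mul_assoc]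
  have hmid : reflectedISWAP (-c) (-s) * cplx (doubleRotation p p' q q')ᵀ -
        cplx (doubleRotation p p' q q')ᵀ * reflectedISWAP c (-s) =
      !![0, 0, p' * (1 - c * Complex.I), p' * (s * Complex.I);
        0, 0, q' * (s * Complex.I), q' * (1 + c * Complex.I);
        p' * (1 + c * Complex.I), q' * (s * Complex.I), -2 * p * c * Complex.I,
          (p - q) * s * Complex.I;
        p' * (s * Complex.I), q' * (1 - c * Complex.I), (q - p) * s * Complex.I,
          2 * q * c * Complex.I] := by
    rw [cplx_doubleRotation_transpose]
    ext i j
    fin_cases i <;> fin_cases j <;>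
      simp [reflectedISWAP] <;>
      ring
  rw [hfac, hmid, det_mul, det_mul, hdet, det_cplx, (mem_specialOrthogonalGroup_iff.1 hB).2]
  simp [det_succ_row_zero, Fin.sum_univ_succ, Fin.succAbove]
  grind

/-! ### Two-gate circuits -/

/-- The equations that the parameters of a two-gate circuit have to satisfy, solved explicitly: here
`X, Y, Z` are the cosines and `S` the product of the sines of the doubled coordinates of the target.
The last equation reads `(1 - p ^ 2) * (1 - q ^ 2) = X² + Y² + Z² - 2XYZ - 1`, so that the
right-hand side has to be nonnegative. -/
theorem exists_doubleRotation_parameters {X Y Z S : ℝ} (hX : 0 ≤ X) (hY : Y ≤ 1) (hZ : 0 ≤ Z)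
    (hZ1 : Z ≤ 1) (hXY : X ≤ Y) (hG : 0 ≤ X ^ 2 + Y ^ 2 + Z ^ 2 - 2 * X * Y * Z - 1)
    (hS : S ^ 2 = (1 - X ^ 2) * (1 - Y ^ 2) * (1 - Z ^ 2)) :
    ∃ p p' q q' g h : ℝ, p ^ 2 + p' ^ 2 = 1 ∧ q ^ 2 + q' ^ 2 = 1 ∧ g ^ 2 + h ^ 2 = 1 ∧
      (2 * g * h) ^ 2 * (p + q) ^ 2 = 4 * (X * Y * Z) ∧
      2 * (g ^ 2 - h ^ 2) * (p' ^ 2 - q' ^ 2) = 4 * S ∧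
      4 * p' ^ 2 * q' ^ 2 = 4 * (X ^ 2 + Y ^ 2 + Z ^ 2 - 2 * X * Y * Z - 1) := by
  have hY0 : 0 ≤ Y := hX.trans hXY
  have hX1 : X ≤ 1 := hXY.trans hY
  -- `t` and `u` are the values given to `((p + q) / 2) ^ 2` and `((q - p) / 2) ^ 2`.
  set a := (1 + X) * (1 + Z) * (1 - Y) / 2 with ha
  set t := X * Y * Z + a with ht
  set u := (1 - X) * (1 - Z) * (1 + Y) / 2 with hu
  have ha0 : 0 ≤ a := by
    have := mul_nonneg (mul_nonneg (by linarith : 0 ≤ 1 + X) (by linarith : 0 ≤ 1 + Z))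
      (by linarith : 0 ≤ 1 - Y)
    positivity
  have hXYZ : 0 ≤ X * Y * Z := by positivity
  have ht0 : 0 ≤ t := by positivity
  have hu0 : 0 ≤ u := by
    have := mul_nonneg (mul_nonneg (by linarith : 0 ≤ 1 - X) (by linarith : 0 ≤ 1 - Z))
      (by linarith : 0 ≤ 1 + Y)
    positivity
  have htu : t - u = X - Y + Z := by rw [ht, ha, hu]; ring
  have htu1 : t - u ≤ 1 := by linarith
  have htu2 : -1 ≤ t - u := by linarith
  set p := √t - √u with hp
  set q := √t + √u with hq
  have ht2 : √t ^ 2 = t := Real.sq_sqrt ht0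
  have hu2 : √u ^ 2 = u := Real.sq_sqrt hu0
  have hpq : p * q = t - u := by rw [hp, hq]; linear_combination ht2 - hu2
  have hprod : (1 - p ^ 2) * (1 - q ^ 2) = X ^ 2 + Y ^ 2 + Z ^ 2 - 2 * X * Y * Z - 1 := by
    have h1 : p ^ 2 + q ^ 2 = 2 * (t + u) := by
      rw [hp, hq]; linear_combination 2 * ht2 + 2 * hu2
    have h2 : (1 - p ^ 2) * (1 - q ^ 2) = 1 - 2 * (t + u) + (t - u) ^ 2 := by
      linear_combination (p * q + (t - u)) * hpq - h1
    rw [h2, htu, ht, hu, ha]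
    ring
  have hpq1 : p ^ 2 * q ^ 2 ≤ 1 := by
    rw [← mul_pow, hpq, sq_le_one_iff_abs_le_one, abs_le]
    exact ⟨htu2, htu1⟩
  -- The factors `1 - p ^ 2` and `1 - q ^ 2` have nonnegative product and are not both negative.
  have hp1 : 0 ≤ 1 - p ^ 2 := by
    by_contra h
    push Not at h
    have : 1 ≤ q ^ 2 := by
      by_contra h'
      push Not at h'
      have := mul_neg_of_neg_of_pos h (by linarith : 0 < 1 - q ^ 2)
      linarith
    nlinarith
  have hq1 : 0 ≤ 1 - q ^ 2 := by
    by_contra h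
    push Not at h
    have : 1 ≤ p ^ 2 := by
      by_contra h'
      push Not at h'
      have := mul_neg_of_pos_of_neg (by linarith : 0 < 1 - p ^ 2) h
      linarith
    nlinarith
  have hS' : S ^ 2 = 4 * a * u := by rw [hS, ha, hu]; ring
  -- `c` is the cosine of twice the angle of the rotation with parameters `g, h`.
  obtain ⟨c, hc1, hct, hcS⟩ : ∃ c : ℝ, c ^ 2 ≤ 1 ∧ c ^ 2 * t = a ∧ 2 * c * √t * √u = S := by
    -- If `t = 0`, then `a = 0` and `S = 0`, and `c` is arbitrary.
    rcases ht0.eq_or_lt' with h0 | hpos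
    · have ha' : a = 0 := by linarith
      refine ⟨0, by norm_num, by rw [ha']; ring, ?_⟩
      rw [ha'] at hS'
      have : S = 0 := by
        apply pow_eq_zero_iff (two_ne_zero) |>.1
        rw [hS']; ring
      rw [this]; ring
    · have hsq : √(a / t) ^ 2 = a / t := Real.sq_sqrt (by positivity)
      have hat : a / t * t = a := div_mul_cancel₀ _ hpos.ne'
      have hle : a / t ≤ 1 := by rw [div_le_one hpos]; linarith
      have habs : 2 * √(a / t) * √t * √u = |S| := by
        rw [← Real.sqrt_sq_eq_abs, hS', mul_assoc, mul_assoc, ← Real.sqrt_mul ht0,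
          ← Real.sqrt_mul (by positivity), ← mul_assoc (a / t), hat, mul_assoc 4 a u,
          Real.sqrt_mul (by norm_num : (0 : ℝ) ≤ 4), show (4 : ℝ) = 2 ^ 2 by norm_num,
          Real.sqrt_sq (by norm_num)]
      rcases le_total 0 S with h | h
      · rw [abs_of_nonneg h] at habs
        exact ⟨√(a / t), by rwa [hsq], by rw [hsq, hat], habs⟩
      · rw [abs_of_nonpos h] at habs
        refine ⟨-√(a / t), by rwa [neg_sq, hsq], by rw [neg_sq, hsq, hat], ?_⟩
        linear_combination -habs
  obtain ⟨hc2, hc3⟩ := abs_le.1 ((sq_le_one_iff_abs_le_one c).1 hc1)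
  have hg : √((1 + c) / 2) ^ 2 = (1 + c) / 2 := Real.sq_sqrt (by linarith)
  have hh : √((1 - c) / 2) ^ 2 = (1 - c) / 2 := Real.sq_sqrt (by linarith)
  have hp' : √(1 - p ^ 2) ^ 2 = 1 - p ^ 2 := Real.sq_sqrt hp1
  have hq' : √(1 - q ^ 2) ^ 2 = 1 - q ^ 2 := Real.sq_sqrt hq1
  refine ⟨p, √(1 - p ^ 2), q, √(1 - q ^ 2), √((1 + c) / 2), √((1 - c) / 2), ?_, ?_, ?_, ?_, ?_, ?_⟩
  · rw [hp']; ring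
  · rw [hq']; ring
  · rw [hg, hh]; ring
  · rw [mul_pow, mul_pow, hg, hh, hp, hq]
    linear_combination 4 * (1 - c ^ 2) * ht2 - 4 * hct
  · rw [hg, hh, hp', hq', hp, hq]
    linear_combination 4 * hcS
  · rw [hp', hq']
    linear_combination 4 * hprod

/-- The circuit `SQiSW · O · SQiSW`, with `O = G B G` for a rotation `G` of the last two coordinates
and a double rotation `B`, has enough parameters to reach these canonical gates. -/
theorem isSQiSWCircuit_two_of_cos {x y z : ℝ} (hx : 0 ≤ Real.cos (2 * x))
    (hz : 0 ≤ Real.cos (2 * z)) (hxy : Real.cos (2 * x) ≤ Real.cos (2 * y))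
    (hG : 0 ≤ Real.cos (2 * x) ^ 2 + Real.cos (2 * y) ^ 2 + Real.cos (2 * z) ^ 2 -
      2 * Real.cos (2 * x) * Real.cos (2 * y) * Real.cos (2 * z) - 1) :
    IsSQiSWCircuit 2 (ofMagic (canonicalGate x y z)) := by
  have hS : (Real.sin (2 * x) * Real.sin (2 * y) * Real.sin (2 * z)) ^ 2 =
      (1 - Real.cos (2 * x) ^ 2) * (1 - Real.cos (2 * y) ^ 2) * (1 - Real.cos (2 * z) ^ 2) := by
    rw [mul_pow, mul_pow, Real.sin_sq, Real.sin_sq, Real.sin_sq]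
  obtain ⟨p, p', q, q', g, h, hp, hq, hgh, htr, him, hdet⟩ := exists_doubleRotation_parameters hx
    (Real.cos_le_one _) hz (Real.cos_le_one _) hxy hG hS
  set D := canonicalGate (Real.pi / 8) (Real.pi / 8) 0 with hD
  set E := canonicalGate (Real.pi / 4) (Real.pi / 4) 0 with hE
  set G := cplx (lastPlaneRotation g h) with hGdef
  set G' := cplx (lastPlaneRotation g h)ᵀ with hGdef'
  set B := cplx (doubleRotation p p' q q') with hB
  set B' := cplx (doubleRotation p p' q q')ᵀ with hB'
  have hDD : D * D = E := by
    rw [hD, canonicalGate_mul]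
    congr 1 <;> ring
  have hDt : Dᵀ = D := by rw [hD, canonicalGate, diagonal_transpose]
  have hcs : (g ^ 2 - h ^ 2) ^ 2 + (2 * g * h) ^ 2 = 1 := by
    linear_combination (g ^ 2 + h ^ 2 + 1) * hgh
  have hGm := lastPlaneRotation_mem hgh
  have hBm := doubleRotation_mem hp hq
  let O := lastPlaneRotation g h * doubleRotation p p' q q' * lastPlaneRotation g h
  have hO : O ∈ specialOrthogonalGroup (Fin 4) ℝ := mul_mem (mul_mem hGm hBm) hGm
  have hcO : cplx O = G * B * G := by simp only [O, map_mul, hGdef, hB]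
  have hcOt : (cplx O)ᵀ = G' * B' * G' := by
    rw [← cplx_transpose]
    simp only [O, transpose_mul, map_mul, hGdef', hB', Matrix.mul_assoc]
  -- `V` is the circuit. Up to a cyclic permutation of its factors `Vᵀ V` is `F' (Bᵀ F B)`, where
  -- `F' = G E Gᵀ` and `F = Gᵀ E G`.
  let V := D * cplx O * D
  have hVV : Vᵀ * V = D * (G' * (B' * (G' * E * G) * B) * G) * D := by
    simp only [V]
    rw [transpose_mul, transpose_mul, hDt, hcOt, hcO, ← hDD]
    simp only [Matrix.mul_assoc]
  have hF : G' * E * G = reflectedISWAP (g ^ 2 - h ^ 2) (-(2 * g * h)) :=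
    transpose_mul_iSWAP_mul_lastPlaneRotation g h
  have hF' : G * E * G' = reflectedISWAP (g ^ 2 - h ^ 2) (2 * g * h) :=
    lastPlaneRotation_mul_iSWAP_mul_transpose g h
  have hVtr : (Vᵀ * V).trace = (G * E * G' * (B' * (G' * E * G) * B)).trace := by
    rw [hVV, trace_mul_comm, ← Matrix.mul_assoc, hDD, ← Matrix.mul_assoc E, trace_mul_comm]
    simp only [Matrix.mul_assoc]
  have hVdet : (1 - Vᵀ * V).det = (1 - G * E * G' * (B' * (G' * E * G) * B)).det := by
    rw [hVV, det_one_sub_mul_comm, ← Matrix.mul_assoc, hDD, ← Matrix.mul_assoc E,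
      det_one_sub_mul_comm]
    simp only [Matrix.mul_assoc]
  have hDm : D ∈ unitaryGroup (Fin 4) ℂ := canonicalGate_mem_unitaryGroup ..
  have hV : V ∈ unitaryGroup (Fin 4) ℂ := mul_mem (mul_mem hDm (cplx_mem_unitaryGroup hO)) hDm
  have hV1 : V.det = 1 := by
    rw [det_mul, det_mul, hD, det_canonicalGate, det_cplx, (mem_specialOrthogonalGroup_iff.1 hO).2]
    simp
  have hcirc : IsSQiSWCircuit 2 (ofMagic V) := by
    have h1 : IsSQiSWCircuit 1 (ofMagic D) := by
      have := isSQiSWCircuit_one.mul_SQiSW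
      rwa [Matrix.one_mul, SQiSW_eq_ofMagic_canonicalGate] at this
    have h2 := (h1.ofMagic_rotation_mul_mul (one_mem _) hO).mul_SQiSW
    rwa [map_one, Matrix.one_mul, SQiSW_eq_ofMagic_canonicalGate, ← ofMagic_mul] at h2
  refine hcirc.of_invariants_eq hV (canonicalGate_mem_unitaryGroup ..) hV1 (det_canonicalGate ..)
    ?_ ?_
  · rw [hVtr, hF, hF', trace_reflectedISWAP_mul hcs, canonicalGate_transpose_mul_self,
      trace_canonicalGate, htr, him]
    push_cast
    ring
  · rw [hVdet, hF, hF', det_one_sub_reflectedISWAP_mul hp hq hcs, hdet,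
      canonicalGate_transpose_mul_self, det_one_sub_canonicalGate]
    push_cast
    ring

/-- The left-hand side factors as `(cos 2(y + z) - cos 2x) (cos 2(y - z) - cos 2x)`. -/
theorem cos_invariant_nonneg {x y z : ℝ} (hx : |x| ≤ Real.pi / 4) (h : |y| + |z| ≤ |x|) :
    0 ≤ Real.cos (2 * x) ^ 2 + Real.cos (2 * y) ^ 2 + Real.cos (2 * z) ^ 2 -
      2 * Real.cos (2 * x) * Real.cos (2 * y) * Real.cos (2 * z) - 1 := by
  have key : ∀ w, |w| ≤ |x| → 0 ≤ Real.cos (2 * w) - Real.cos (2 * x) := by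
    intro w hw
    rw [sub_nonneg, ← Real.cos_abs (2 * x), ← Real.cos_abs (2 * w), abs_mul, abs_mul, abs_two]
    exact Real.cos_le_cos_of_nonneg_of_le_pi (by positivity) (by linarith [Real.pi_pos])
      (by linarith)
  have h1 := key (y + z) ((abs_add_le y z).trans h)
  have h2 := key (y - z) ((abs_sub y z).trans h)
  have h3 := mul_nonneg h1 h2
  rw [mul_add 2 y, mul_sub 2 y, Real.cos_add, Real.cos_sub] at h3
  have hy := Real.sin_sq_add_cos_sq (2 * y)
  have hz := Real.sin_sq_add_cos_sq (2 * z)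
  refine h3.trans_eq ?_
  linear_combination (-Real.sin (2 * z) ^ 2) * hy - (1 - Real.cos (2 * y) ^ 2) * hz

theorem cos_two_mul_nonneg {x : ℝ} (hx : |x| ≤ Real.pi / 4) : 0 ≤ Real.cos (2 * x) := by
  obtain ⟨h1, h2⟩ := abs_le.1 hx
  exact Real.cos_nonneg_of_neg_pi_div_two_le_of_le (by linarith) (by linarith)

/-- The part of the Weyl chamber that two gates reach: the largest coordinate is at least the sum of
the absolute values of the other two. -/
theorem isSQiSWCircuit_two {x y z : ℝ} (hx : |x| ≤ Real.pi / 4) (h : |y| + |z| ≤ |x|) :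
    IsSQiSWCircuit 2 (ofMagic (canonicalGate x y z)) := by
  have hz : |z| ≤ Real.pi / 4 := by linarith [abs_nonneg y]
  have hxy : Real.cos (2 * x) ≤ Real.cos (2 * y) := by
    rw [← Real.cos_abs (2 * x), ← Real.cos_abs (2 * y), abs_mul, abs_mul, abs_two]
    exact Real.cos_le_cos_of_nonneg_of_le_pi (by positivity) (by linarith [Real.pi_pos])
      (by linarith [abs_nonneg z])
  exact isSQiSWCircuit_two_of_cos (cos_two_mul_nonneg hx) (cos_two_mul_nonneg hz) hxy
    (cos_invariant_nonneg hx h)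

/-- A canonical gate with the local invariants of `SQiSW` costs one more gate. -/
theorem IsSQiSWCircuit.mul_canonicalGate {n : ℕ} {V : Matrix (Fin 4) (Fin 4) ℂ}
    (hV : IsSQiSWCircuit n (ofMagic V)) {x y z : ℝ}
    (hc : Real.cos (2 * x) * Real.cos (2 * y) * Real.cos (2 * z) = 1 / 2)
    (hs : Real.sin (2 * x) * Real.sin (2 * y) * Real.sin (2 * z) = 0)
    (hsq : Real.cos (2 * x) ^ 2 + Real.cos (2 * y) ^ 2 + Real.cos (2 * z) ^ 2 = 2) :
    IsSQiSWCircuit (n + 1) (ofMagic (V * canonicalGate x y z)) := by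
  have hcos : Real.cos (2 * (Real.pi / 8)) * Real.cos (2 * (Real.pi / 8)) = 1 / 2 := by
    rw [show 2 * (Real.pi / 8) = Real.pi / 4 by ring, Real.cos_pi_div_four]
    linear_combination (1 / 4 : ℝ) * Real.sq_sqrt (by norm_num : (0 : ℝ) ≤ 2)
  obtain ⟨K, hK, L, hL, h⟩ := exists_rotations_of_invariants_eq
    (canonicalGate_mem_unitaryGroup (Real.pi / 8) (Real.pi / 8) 0)
    (canonicalGate_mem_unitaryGroup x y z) (det_canonicalGate ..) (det_canonicalGate ..)
    (by
      rw [canonicalGate_transpose_mul_self, canonicalGate_transpose_mul_self, trace_canonicalGate,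
        trace_canonicalGate]
      have hc' := congrArg Complex.ofReal hc
      have hs' := congrArg Complex.ofReal hs
      simp only [Complex.ofReal_mul] at hc' hs'
      rw [hc', hs', ← Complex.ofReal_mul, hcos]
      simp)
    (by
      rw [canonicalGate_transpose_mul_self, canonicalGate_transpose_mul_self,
        det_one_sub_canonicalGate, det_one_sub_canonicalGate]
      congr 2
      rw [mul_zero, Real.cos_zero]
      linear_combination -hsq + 2 * hc)
  have h1 := (hV.ofMagic_rotation_mul_mul (one_mem _) hK).mul_SQiSW
  rw [map_one, Matrix.one_mul, SQiSW_eq_ofMagic_canonicalGate, ← ofMagic_mul] at h1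
  have h2 := h1.ofMagic_rotation_mul_mul (one_mem _) hL
  rw [map_one, Matrix.one_mul, Matrix.mul_assoc, Matrix.mul_assoc, ← Matrix.mul_assoc (cplx K),
    ← h] at h2
  exact h2

/-! ### Three-gate circuits -/

/-- Shifting a coordinate by `π/2` multiplies by a phase and a rotation, that is, by single-qubit
gates. -/
theorem canonicalGate_pi_div_two : canonicalGate (Real.pi / 2) 0 0 =
    Complex.I • cplx (diagonal ![1, -1, 1, -1]) := by
  have h2 : Complex.exp (-(Real.pi / 2) * Complex.I) = -Complex.I :=
    (congrArg Complex.exp (by ring)).trans Complex.exp_neg_pi_div_two_mul_I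
  have h3 : cplx (diagonal ![1, -1, 1, -1]) = diagonal ![1, -1, 1, -1] := by
    ext i j
    fin_cases i <;> fin_cases j <;> simp [cplx_apply]
  rw [h3, canonicalGate, ← diagonal_smul]
  congr 1
  ext i
  fin_cases i
  · simp
  · simpa using h2
  · simp
  · simpa using h2

theorem diagonal_sign_mem : diagonal ![1, -1, 1, -1] ∈ specialOrthogonalGroup (Fin 4) ℝ := by
  rw [mem_specialOrthogonalGroup_iff, mem_orthogonalGroup_iff, diagonal_transpose,
    diagonal_mul_diagonal, ← diagonal_one]
  constructor
  · congr 1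
    ext i
    fin_cases i <;> simp
  · simp [Fin.prod_univ_four]

theorem IsSQiSWCircuit.canonicalGate_add_pi_div_two {n : ℕ} {x y z : ℝ}
    (h : IsSQiSWCircuit n (ofMagic (canonicalGate x y z))) :
    IsSQiSWCircuit n (ofMagic (canonicalGate (x + Real.pi / 2) y z)) := by
  have h1 := h.ofMagic_rotation_mul_mul (one_mem _) diagonal_sign_mem
  have h2 := h1.smul (a := Complex.I) (by simp [Unitary.mem_iff])
  rw [map_one, Matrix.one_mul, ← ofMagic_smul, ← mul_smul_comm, ← canonicalGate_pi_div_two,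
    canonicalGate_mul, add_zero, add_zero] at h2
  exact h2

theorem isSQiSWCircuit_canonicalGate_periodic (n : ℕ) (y z : ℝ) :
    Function.Periodic (fun x => IsSQiSWCircuit n (ofMagic (canonicalGate x y z)))
      (Real.pi / 2) := by
  intro x
  refine propext ⟨fun h => ?_, fun h => h.canonicalGate_add_pi_div_two⟩
  have hx : 2 * (x + Real.pi / 2 + Real.pi / 2) = 2 * x + 2 * Real.pi := by ring
  refine h.canonicalGate_add_pi_div_two.canonicalGate_congr ?_ ?_ ?_ <;>
    simp only [hx, Real.cos_add_two_pi, Real.sin_add_two_pi]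

/-- The operators of the circuits with at most three SQiSW gates. -/
def IsShortCircuit (U : TwoQubitMatrix) : Prop := ∃ n ≤ 3, IsSQiSWCircuit n U

theorem isShortCircuit_canonicalGate_swap {x y z : ℝ}
    (h : IsShortCircuit (ofMagic (canonicalGate x y z))) :
    IsShortCircuit (ofMagic (canonicalGate y x z)) := by
  obtain ⟨n, hn, h⟩ := h
  exact ⟨n, hn, h.canonicalGate_congr (by ring) (by ring) (by ring)⟩

theorem isShortCircuit_canonicalGate_rotate {x y z : ℝ}
    (h : IsShortCircuit (ofMagic (canonicalGate x y z))) :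
    IsShortCircuit (ofMagic (canonicalGate y z x)) := by
  obtain ⟨n, hn, h⟩ := h
  exact ⟨n, hn, h.canonicalGate_congr (by ring) (by ring) (by ring)⟩

/-- Moving `y` by `a` towards `0` or away from it. -/
theorem exists_shift (y : ℝ) {a : ℝ} (ha : 0 ≤ a) :
    ∃ s, (s = a ∨ s = -a) ∧ |y - s| = |(|y| - a)| ∧ |y + s| = |y| + a := by
  rcases le_total 0 y with h | h
  · refine ⟨a, Or.inl rfl, by rw [abs_of_nonneg h], ?_⟩
    rw [abs_of_nonneg h, abs_of_nonneg (by linarith)]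
  · refine ⟨-a, Or.inr rfl, ?_, ?_⟩
    · rw [abs_of_nonpos h, ← abs_neg]
      congr 1
      ring
    · rw [abs_of_nonpos h, abs_of_nonpos (by linarith)]
      ring

/-- Canonical gates multiply by adding coordinates, and `SQiSW` is locally equivalent to the
canonical gate with coordinates `(±π/8, ±π/8, 0)`. -/
theorem IsSQiSWCircuit.canonicalGate_add {n : ℕ} {x y z s t : ℝ}
    (h : IsSQiSWCircuit n (ofMagic (canonicalGate x y z)))
    (hs : s = Real.pi / 8 ∨ s = -(Real.pi / 8)) (ht : t = Real.pi / 8 ∨ t = -(Real.pi / 8)) :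
    IsSQiSWCircuit (n + 1) (ofMagic (canonicalGate (x + s) (y + t) z)) := by
  have hcos : ∀ r : ℝ, r = Real.pi / 8 ∨ r = -(Real.pi / 8) → Real.cos (2 * r) = √2 / 2 := by
    rintro r (rfl | rfl)
    · rw [← Real.cos_pi_div_four]
      congr 1
      ring
    · rw [← Real.cos_pi_div_four, ← Real.cos_neg]
      congr 1
      ring
  have h2 : √2 ^ 2 = (2 : ℝ) := Real.sq_sqrt (by norm_num)
  have := h.mul_canonicalGate (x := s) (y := t) (z := 0)
    (by rw [hcos s hs, hcos t ht, mul_zero, Real.cos_zero]; linear_combination (1 / 4 : ℝ) * h2)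
    (by simp)
    (by rw [hcos s hs, hcos t ht, mul_zero, Real.cos_zero]; linear_combination (1 / 2 : ℝ) * h2)
  rwa [canonicalGate_mul, add_zero] at this

/-- Three gates reach the Weyl chamber: unless two gates suffice, moving two of the coordinates by
`π/8` leads into the part that two gates reach. -/
theorem isShortCircuit_of_sorted {x y z : ℝ} (hx : |x| ≤ Real.pi / 4) (hyx : |y| ≤ |x|)
    (hzy : |z| ≤ |y|) : IsShortCircuit (ofMagic (canonicalGate x y z)) := by
  have hpi : 0 ≤ Real.pi / 8 := by positivity
  have hz := abs_nonneg z
  obtain ⟨s, hs, hys, -⟩ := exists_shift y hpi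
  by_cases hsum : Real.pi / 4 ≤ |x| + |y| + |z|
  -- Move both `y` and `z` towards `0`.
  · obtain ⟨t, ht, hzt, -⟩ := exists_shift z hpi
    have h : IsSQiSWCircuit 2 (ofMagic (canonicalGate x (y - s) (z - t))) := by
      refine isSQiSWCircuit_two hx ?_
      rw [hys, hzt]
      rcases abs_cases (|y| - Real.pi / 8) with h1 | h1 <;>
        rcases abs_cases (|z| - Real.pi / 8) with h2 | h2 <;> linarith
    have h' := (h.canonicalGate_congr (x' := y - s) (y' := z - t) (z' := x) (by ring) (by ring)
      (by ring)).canonicalGate_add hs ht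
    rw [sub_add_cancel, sub_add_cancel] at h'
    exact ⟨3, le_rfl, h'.canonicalGate_congr (by ring) (by ring) (by ring)⟩
  · push Not at hsum
    by_cases hx8 : |x| ≤ Real.pi / 8
    -- Move `x` away from `0` and `y` towards `0`, past it.
    · obtain ⟨t, ht, -, hxt⟩ := exists_shift x hpi
      have h : IsSQiSWCircuit 2 (ofMagic (canonicalGate (x + t) (y - s) z)) := by
        refine isSQiSWCircuit_two (by rw [hxt]; linarith) ?_
        rw [hys, hxt]
        rcases abs_cases (|y| - Real.pi / 8) with h1 | h1 <;> linarith
      have ht' : -t = Real.pi / 8 ∨ -t = -(Real.pi / 8) := by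
        rcases ht with rfl | rfl
        · exact Or.inr rfl
        · exact Or.inl (neg_neg _)
      have h' := h.canonicalGate_add ht' hs
      rw [add_neg_cancel_right, sub_add_cancel] at h'
      exact ⟨3, le_rfl, h'⟩
    · exact ⟨2, by norm_num, isSQiSWCircuit_two hx (by linarith)⟩

theorem isShortCircuit_canonicalGate (x y z : ℝ) :
    IsShortCircuit (ofMagic (canonicalGate x y z)) := by
  have hper : ∀ y z, Function.Periodic (fun x => IsShortCircuit (ofMagic (canonicalGate x y z)))
      (Real.pi / 2) := by
    intro y z x
    exact propext <| exists_congr fun n =>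
      and_congr_right' (isSQiSWCircuit_canonicalGate_periodic n y z x).to_iff
  -- Up to a shift by a multiple of `π/2` each coordinate lies in `[-π/4, π/4]`.
  have reduce : ∀ x y z, (∀ x', |x'| ≤ Real.pi / 4 →
      IsShortCircuit (ofMagic (canonicalGate x' y z))) →
      IsShortCircuit (ofMagic (canonicalGate x y z)) := by
    intro x y z h
    obtain ⟨x', ⟨h1, h2⟩, hx'⟩ := (hper y z).exists_mem_Ico (by positivity) x (-(Real.pi / 4))
    exact hx'.mpr <| h x' (abs_le.2 ⟨h1, by linarith⟩)
  refine reduce x y z fun x hx => ?_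
  refine isShortCircuit_canonicalGate_rotate (isShortCircuit_canonicalGate_rotate
    (reduce y z x fun y hy => ?_))
  refine isShortCircuit_canonicalGate_rotate (isShortCircuit_canonicalGate_rotate
    (reduce z x y fun z hz => ?_))
  rcases le_total |x| |y| with h1 | h1
  · rcases le_total |y| |z| with h2 | h2
    · exact isShortCircuit_canonicalGate_rotate
        (isShortCircuit_canonicalGate_swap (isShortCircuit_of_sorted hz h2 h1))
    · rcases le_total |x| |z| with h3 | h3
      · exact isShortCircuit_canonicalGate_rotate (isShortCircuit_of_sorted hy h2 h3)
      · exact isShortCircuit_canonicalGate_rotate (isShortCircuit_canonicalGate_rotate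
          (isShortCircuit_canonicalGate_swap (isShortCircuit_of_sorted hy h1 h3)))
  · rcases le_total |x| |z| with h2 | h2
    · exact isShortCircuit_of_sorted hz h2 h1
    · rcases le_total |y| |z| with h3 | h3
      · exact isShortCircuit_canonicalGate_swap (isShortCircuit_of_sorted hx h2 h3)
      · exact isShortCircuit_canonicalGate_rotate (isShortCircuit_canonicalGate_rotate
          (isShortCircuit_of_sorted hx h1 h3))

theorem exists_canonicalGate_eq_diagonal {d : Fin 4 → ℂ} (hd : ∀ i, d i * star (d i) = 1)
    (hd1 : ∏ i, d i = 1) : ∃ x y z : ℝ, canonicalGate x y z = diagonal d := by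
  have hexp : ∀ i, Complex.exp (Complex.arg (d i) * Complex.I) = d i := by
    intro i
    have h1 : ‖d i‖ = 1 := by
      have := hd i
      rw [Complex.star_def, Complex.mul_conj'] at this
      have h2 : ‖d i‖ ^ 2 = 1 := by exact_mod_cast this
      exact (pow_eq_one_iff_of_nonneg (norm_nonneg _) two_ne_zero).1 h2
    have := Complex.norm_mul_exp_arg_mul_I (d i)
    rwa [h1, Complex.ofReal_one, one_mul] at this
  refine ⟨(Complex.arg (d 0) + Complex.arg (d 2)) / 2, (Complex.arg (d 1) + Complex.arg (d 2)) / 2,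
    (Complex.arg (d 0) + Complex.arg (d 1)) / 2, ?_⟩
  rw [canonicalGate]
  congr 1
  ext i
  push_cast
  fin_cases i
  · exact (congrArg Complex.exp (by ring)).trans (hexp 0)
  · exact (congrArg Complex.exp (by ring)).trans (hexp 1)
  · exact (congrArg Complex.exp (by ring)).trans (hexp 2)
  · rw [Fin.prod_univ_four] at hd1
    refine Eq.trans ?_ (eq_inv_of_mul_eq_one_right hd1).symm
    rw [← hexp 0, ← hexp 1, ← hexp 2, ← Complex.exp_add, ← Complex.exp_add, ← Complex.exp_neg]
    rw [hexp 0, hexp 1, hexp 2]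
    exact congrArg Complex.exp (by ring)

/-- Every `V` of determinant `1` has the local invariants of a canonical gate, whose coordinates are
half those of the diagonalized `Vᵀ V`. -/
theorem isShortCircuit_of_det_eq_one {V : Matrix (Fin 4) (Fin 4) ℂ}
    (hV : V ∈ unitaryGroup (Fin 4) ℂ) (hdet : V.det = 1) : IsShortCircuit (ofMagic V) := by
  obtain ⟨R, hR, d, -, hd, hd1, htr, hdt⟩ := exists_rotation_diagonal hV hdet
  obtain ⟨x, y, z, hxyz⟩ := exists_canonicalGate_eq_diagonal hd hd1
  obtain ⟨n, hn, h⟩ := isShortCircuit_canonicalGate (x / 2) (y / 2) (z / 2)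
  have hsq : (canonicalGate (x / 2) (y / 2) (z / 2))ᵀ * canonicalGate (x / 2) (y / 2) (z / 2) =
      diagonal d := by
    rw [canonicalGate_transpose_mul_self, ← hxyz]
    congr 1 <;> ring
  refine ⟨n, hn, h.of_invariants_eq (canonicalGate_mem_unitaryGroup ..) hV (det_canonicalGate ..)
    hdet ?_ ?_⟩
  · rw [hsq, htr, trace_diagonal]
  · rw [hsq, hdt, ← diagonal_one, diagonal_sub, det_diagonal]

theorem mainTheorem1 (U : Matrix.unitaryGroup (Fin 2 × Fin 2) ℂ) :
    ∃ n : ℕ, n ≤ 3 ∧ IsSQiSWCircuit n (U : TwoQubitMatrix) := by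
  obtain ⟨V, hVU⟩ := ofMagic_surjective (U : TwoQubitMatrix)
  have hV : V ∈ unitaryGroup (Fin 4) ℂ := ofMagic_mem_unitaryGroup.1 (hVU ▸ U.2)
  obtain ⟨b, hb⟩ := IsAlgClosed.exists_pow_nat_eq V.det (n := 4) (by norm_num)
  have hb1 : b ∈ unitary ℂ := by
    have h1 : ‖V.det‖ = 1 := CStarRing.norm_of_mem_unitary (det_of_mem_unitary hV)
    rw [← hb, norm_pow, pow_eq_one_iff_of_nonneg (norm_nonneg _) (by norm_num)] at h1
    rw [Unitary.mem_iff_self_mul_star, Complex.star_def, Complex.mul_conj', h1]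
    simp
  have hb2 : star b ∈ unitary ℂ := Unitary.star_mem hb1
  have hW : star b • V ∈ unitaryGroup (Fin 4) ℂ := by
    rw [mem_unitaryGroup_iff, star_smul, smul_mul_smul_comm, mem_unitaryGroup_iff.1 hV,
      Unitary.mul_star_self_of_mem hb2, one_smul]
  have hW1 : (star b • V).det = 1 := by
    rw [det_smul, ← hb, Fintype.card_fin, ← mul_pow, Unitary.star_mul_self_of_mem hb1, one_pow]
  obtain ⟨n, hn, h⟩ := isShortCircuit_of_det_eq_one hW hW1
  refine ⟨n, hn, ?_⟩
  have := h.smul hb1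
  rwa [← ofMagic_smul, smul_smul, Unitary.mul_star_self_of_mem hb1, one_smul, hVU] at this
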